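/- **Setting.** Let $k,K,\lambda>0$, and let $\mu,\sigma:[0,\infty)\to\mathbb R$ satisfy: $|\mu(x)|+|\sigma(x)|\le C(1+x)$ for some $C>0$ and all $x\ge0$; $\mu,\sigma$ are continuously differentiable and Lipschitz with Lipschitz derivatives; $\sigma^2>0$; there is $x_\lambda\in[0,\infty)$ with $\mu'(x)>\lambda$ for $x<x_\lambda$ and $\mu'(x)\le\lambda$ for $x\ge x_\lambda$. Put $Lf=\tfrac12\sigma^2f''+\mu f'-\lambda f$. Let $g_1,g_2$ be $C^2$ solutions of $Lf=0$ on $[0,\infty)$ with $g_1(0)=1$, $g_1'(x_\lambda)=0$, and $g_2(0)=1$, $g_2'(0)>0$, $g_2$ strictly increasing. Write $g(x;\beta)=g_2(x)-\beta g_1(x)$, $g'(x;\beta)=\frac{\partial}{\partial x}g(x;\beta)$, and $g(x)=g(x;1)$. Assume: * there is $0<x_1^*\le x_\lambda$ such that $g$ is convex on $[0,x_1^*)$ and concave on $[x_1^*,\infty)$; * there are $c>0$, $u>0$ with $cg'(u)=k$, $cg(u)=ku-K$; let $(c^*,\bar u^*)$ be such a pair $(c,u)$ with $c$ maximal; * $\mu(x_\lambda)k-\lambda(kx_\lambda-K)>0$;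 * $c^*\ge c^\infty:=k/g'_\infty$, where $g'_\infty=\lim_{x\to\infty}g'(x)$ (with $c^\infty=\infty$ if $g_\infty'=0$). **Definitions.** Let $\underline z$ be the unique point of $(x_1^*,x_\lambda)$ with $\mu(\underline z)k-\lambda(k\underline z-K)=0$. Let $h=g_2''/g_1''$ and $h_\infty=\lim_{x\to\infty}h(x)$; $h$ is strictly decreasing on $[x_1^*,x_\lambda]$ and nondecreasing on $[x_\lambda,\infty)$. Let $h_-^{-1}(\beta)$ be the point of $[x_1^*,x_\lambda]$ and $h_+^{-1}(\beta)$ the (first) point of $[x_\lambda,\infty)$ at which $h=\beta$. Let $$\gamma(\beta,x)=k\Big(\frac{g(x;\beta)}{g'(x;\beta)}-x\Big)+K ,\qquad J(\beta,a,b)=k\int_a^b\Big(1-\frac{g'(x;\beta)}{g'(b;\beta)}\Big)dx .$$ For $\beta\in[h(\underline z),1]$ let $u_1(\beta)$ be the unique root of $\gamma(\beta,\cdot)$ in $[\bar u^*,\underline z]$ (where $g'(\cdot;\beta)\neq0$) and $G(\beta)=\lim_{x\to\infty}g'(x;\beta)/g'(u_1(\beta);\beta)$. Let $v(\beta)=g'(h_+^{-1}(\beta);\beta)/g'(u_1(\beta);\beta)$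 for $\beta\in[h(\underline z),1]\cap[h(\underline z),h_\infty)$ and $v(\beta)=\infty$ otherwise, and $$\beta_0=\sup\{\beta_1\in(h(\underline z),1]:\ v(\beta)\le1\text{ for all }\beta\in(h(\underline z),\beta_1]\}.$$ Let $\alpha_0=h(\underline z)$ if $G(h(\underline z))\ge1$; otherwise let $\alpha_0$ be the unique $\alpha_1\in(h(\underline z),\beta_0)$ with $G(\alpha_1)=1$, if it exists. For $\beta\in(\alpha_0,\beta_0)$ let $u_2(\beta)$ and $u_3(\beta)$ be the unique points of $(h_-^{-1}(\beta),h_+^{-1}(\beta))$ and of $(h_+^{-1}(\beta),\infty)$, respectively, where $g'(\cdot;\beta)=g'(u_1(\beta);\beta)$. Put $J_2(\beta)=J(\beta,u_2(\beta),u_3(\beta))$, $J_{13}(\beta)=J(\beta,u_1(\beta),u_3(\beta))$, and let $J_2(\alpha_0),J_{13}(\alpha_0)\in[-\infty,\infty]$ be their limits as $\beta\downarrow\alpha_0$. Consider the cases * **G1.** $G(h(\underline z))\ge1$. * **G2.** $G(h(\underline z))<1$, $\alpha_0$ exists and $J_{13}(\alpha_0)\ge0$. * **G3.** $G(h(\underline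 z))<1$, $\alpha_0$ exists, $J_{13}(\alpha_0)<0$ and $J_2(\alpha_0)>K$. **Proposition 2.2.** Assume that one of G1, G2, G3 holds, but not the borderline situation of G2 in which $J_{13}(\alpha_0)=0$ and $J_2(\alpha_0)\le K$. Assume also that either $h_\infty=1$, or $h(\underline z)<h_\infty<1$ and $G(h_\infty)>1$. Then there is $\tilde\beta\in(\alpha_0,\beta_0)$ such that the numbers $\tilde u_i=u_i(\tilde\beta)$, $i=1,2,3$, satisfy $$\bar u^*<\tilde u_1<h_-^{-1}(\tilde\beta)<\underline z<\tilde u_2<h_+^{-1}(\tilde\beta)<\tilde u_3$$ and * (i) $\gamma(\tilde\beta,\tilde u_1)=0$ (with $g'(\tilde u_1;\tilde\beta)\ne0$); * (ii) $g'(\tilde u_1;\tilde\beta)=g'(\tilde u_2;\tilde\beta)=g'(\tilde u_3;\tilde\beta)$; * (iii) exactly one of the following holds: (iii-a) $-J(\tilde\beta,\tilde u_1,\tilde u_2)=J(\tilde\beta,\tilde u_2,\tilde u_3)\le K$; (iii-b) $-J(\tilde\beta,\tilde u_1,\tilde u_2)>J(\tilde\beta,\tilde u_2,\tilde u_3)=K$.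 In case G3, (iii-b) holds. -/

import Mathlib

open Set Filter Topology
open scoped ENNReal

namespace DividendProblem

/-- Derivative of a function on the half line `[0, ∞)`: one-sided at `0`, and the ordinary
derivative at every `x > 0`. -/
noncomputable def D (f : ℝ → ℝ) : ℝ → ℝ := derivWithin f (Ici 0)

/-- The limit at `∞` as an extended real number, written as an upper limit so that it is total;
it is the limit whenever that exists in `[-∞, ∞]`. -/
noncomputable def limInfty (f : ℝ → ℝ) : EReal := limsup (fun x => (f x : EReal)) atTop

/-- The limit from the right at `a` as an extended real number, written as an upper limit so that
it is total; it is the limit whenever that exists in `[-∞, ∞]`. -/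
noncomputable def limRight (f : ℝ → ℝ) (a : ℝ) : EReal :=
  limsup (fun x => (f x : EReal)) (𝓝[>] a)

/-- Standing assumptions on the drift `μ`, the volatility `σ`, the discounting rate `lam` and the
point `xlam`. -/
structure Coefficients (μ σ : ℝ → ℝ) (lam xlam : ℝ) : Prop where
  linear_growth : ∃ C > 0, ∀ x, 0 ≤ x → |μ x| + |σ x| ≤ C * (1 + x)
  contDiff_drift : ContDiffOn ℝ 1 μ (Ici 0)
  contDiff_vol : ContDiffOn ℝ 1 σ (Ici 0)
  lipschitz_drift : ∃ C, LipschitzOnWith C μ (Ici 0)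
  lipschitz_vol : ∃ C, LipschitzOnWith C σ (Ici 0)
  lipschitz_deriv_drift : ∃ C, LipschitzOnWith C (D μ) (Ici 0)
  lipschitz_deriv_vol : ∃ C, LipschitzOnWith C (D σ) (Ici 0)
  vol_pos : ∀ x, 0 ≤ x → 0 < σ x ^ 2
  rate_pos : 0 < lam
  xlam_nonneg : 0 ≤ xlam
  deriv_drift_gt : ∀ x, 0 ≤ x → x < xlam → lam < D μ x
  deriv_drift_le : ∀ x, xlam ≤ x → D μ x ≤ lam

/-- `f` is a solution on `[0, ∞)` of `L f = σ² f'' / 2 + μ f' - lam f = 0`. -/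
def IsSolution (μ σ : ℝ → ℝ) (lam : ℝ) (f : ℝ → ℝ) : Prop :=
  ContDiffOn ℝ 2 f (Ici 0) ∧
    ∀ x, 0 ≤ x → σ x ^ 2 / 2 * D (D f) x + μ x * D f x - lam * f x = 0

/-- The data from which the functions below are built: drift, volatility, discounting rate, the
constants `k`, `K` of the net payment `k ξ - K`, the point `xlam`, the solutions `g₁`, `g₂`, the
inflection point `x1` of `g₂ - g₁` and the pair `(cstar, ubar)`. -/
structure Data where
  μ : ℝ → ℝ
  σ : ℝ → ℝ
  lam : ℝ
  k : ℝ
  K : ℝ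
  xlam : ℝ
  g₁ : ℝ → ℝ
  g₂ : ℝ → ℝ
  x1 : ℝ
  cstar : ℝ
  ubar : ℝ

namespace Data

variable (S : Data)

/-- `g(x; β) = g₂(x) - β g₁(x)`. -/
def gb (β x : ℝ) : ℝ := S.g₂ x - β * S.g₁ x

/-- `g'(x; β)`. -/
noncomputable def dgb (β x : ℝ) : ℝ := D (S.gb β) x

/-- The canonical solution `g = g₂ - g₁`. -/
def g (x : ℝ) : ℝ := S.g₂ x - S.g₁ x

/-- `c^∞ = k / g'_∞` where `g'_∞ = lim g'(x) ∈ [0, ∞]`; as an extended nonnegative number, so that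
`c^∞ = 0` if `g'_∞ = ∞` and `c^∞ = ∞` if `g'_∞ = 0`. -/
noncomputable def cInf : ℝ≥0∞ := ENNReal.ofReal S.k / (limInfty (D S.g)).toENNReal

/-- `μ(x) k - lam (k x - K)`. -/
def q (x : ℝ) : ℝ := S.μ x * S.k - S.lam * (S.k * x - S.K)

/-- `(c, u)` solves `c g'(u) = k`, `c g(u) = k u - K`. -/
def IsTangentPair (c u : ℝ) : Prop :=
  0 < c ∧ 0 < u ∧ c * D S.g u = S.k ∧ c * S.g u = S.k * u - S.K

/-- The assumptions of the problem in the case where the canonical solution is convex up to `x1` and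
concave from there on. -/
structure Problem : Prop where
  k_pos : 0 < S.k
  K_pos : 0 < S.K
  coefficients : Coefficients S.μ S.σ S.lam S.xlam
  -- the normalized solutions `g₁` and `g₂`
  g₁_solution : IsSolution S.μ S.σ S.lam S.g₁
  g₁_zero : S.g₁ 0 = 1
  g₁_deriv : D S.g₁ S.xlam = 0
  g₂_solution : IsSolution S.μ S.σ S.lam S.g₂
  g₂_zero : S.g₂ 0 = 1
  g₂_strictMono : StrictMonoOn S.g₂ (Ici 0)
  g₂_deriv : 0 < D S.g₂ 0
  -- `g` is convex on `[0, x1)` and concave on `[x1, ∞)`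
  x1_pos : 0 < S.x1
  x1_le : S.x1 ≤ S.xlam
  convex : ConvexOn ℝ (Ico 0 S.x1) S.g
  concave : ConcaveOn ℝ (Ici S.x1) S.g
  -- `(cstar, ubar)`, with the largest possible `cstar`
  tangent : S.IsTangentPair S.cstar S.ubar
  tangent_max : ∀ c u, S.IsTangentPair c u → c ≤ S.cstar
  -- the remaining conditions
  q_xlam_pos : 0 < S.q S.xlam
  cInf_le : S.cInf ≤ ENNReal.ofReal S.cstar

/-- The point `z ∈ (x1, xlam)` with `μ(z) k - lam (k z - K) = 0`. -/
noncomputable def z : ℝ := sInf {x | x ∈ Ioo S.x1 S.xlam ∧ S.q x = 0}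

/-- `h = g₂'' / g₁''`. -/
noncomputable def h (x : ℝ) : ℝ := D (D S.g₂) x / D (D S.g₁) x

/-- `h_∞ = lim h(x)`. -/
noncomputable def hInf : EReal := limInfty S.h

/-- `h_-^{-1}(β)`: the point of `[x1, xlam]` where `h = β`. -/
noncomputable def hMinus (β : ℝ) : ℝ := sInf {x | x ∈ Icc S.x1 S.xlam ∧ S.h x = β}

/-- `h_+^{-1}(β)`: the point of `[xlam, ∞)` where `h = β` (the first one, should `h` be constant on
an interval at this level). -/
noncomputable def hPlus (β : ℝ) : ℝ := sInf {x | x ∈ Ici S.xlam ∧ S.h x = β}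

/-- `γ(β, x) = k (g(x; β) / g'(x; β) - x) + K`, of use where `g'(x; β) ≠ 0`. -/
noncomputable def γ (β x : ℝ) : ℝ := S.k * (S.gb β x / S.dgb β x - x) + S.K

/-- `u₁(β)`: the root of `γ(β, ·)` in `[ubar, z]`. -/
noncomputable def u₁ (β : ℝ) : ℝ :=
  sInf {u | u ∈ Icc S.ubar S.z ∧ S.dgb β u ≠ 0 ∧ S.γ β u = 0}

/-- `u₂(β)`: the point of `(h_-^{-1}(β), h_+^{-1}(β))` where `g'(·; β)` has the same value as at
`u₁(β)`. -/
noncomputable def u₂ (β : ℝ) : ℝ :=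
  sInf {u | u ∈ Ioo (S.hMinus β) (S.hPlus β) ∧ S.dgb β u = S.dgb β (S.u₁ β)}

/-- `u₃(β)`: the point of `(h_+^{-1}(β), ∞)` where `g'(·; β)` has the same value as at `u₁(β)`. -/
noncomputable def u₃ (β : ℝ) : ℝ :=
  sInf {u | u ∈ Ioi (S.hPlus β) ∧ S.dgb β u = S.dgb β (S.u₁ β)}

open scoped Classical in
/-- `v(β) = g'(h_+^{-1}(β); β) / g'(u₁(β); β)` for `β ∈ [h(z), 1] ∩ [h(z), h_∞)`, and `∞`
otherwise. -/
noncomputable def v (β : ℝ) : EReal :=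
  if β ∈ Icc (S.h S.z) 1 ∧ (β : EReal) < S.hInf then
    ((S.dgb β (S.hPlus β) / S.dgb β (S.u₁ β) : ℝ) : EReal)
  else ⊤

/-- `β₀ = sup {β₁ ∈ (h(z), 1] : v ≤ 1 on (h(z), β₁]}`. -/
noncomputable def β₀ : ℝ :=
  sSup {β₁ | β₁ ∈ Ioc (S.h S.z) 1 ∧ ∀ β ∈ Ioc (S.h S.z) β₁, S.v β ≤ 1}

/-- `G(β) = lim g'(x; β) / g'(u₁(β); β)`, with values in `[-∞, ∞]`. -/
noncomputable def G (β : ℝ) : EReal :=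
  limInfty (S.dgb β) / ((S.dgb β (S.u₁ β) : ℝ) : EReal)

/-- `α₁` is a point of `(h(z), β₀)` with `G(α₁) = 1`. -/
def IsAlphaOne (α₁ : ℝ) : Prop := α₁ ∈ Ioo (S.h S.z) S.β₀ ∧ S.G α₁ = 1

open scoped Classical in
/-- `α₀`, which is `h(z)` if `G(h(z)) ≥ 1`, and `α₁` otherwise. -/
noncomputable def α₀ : ℝ :=
  if 1 ≤ S.G (S.h S.z) then S.h S.z else sInf {α₁ | S.IsAlphaOne α₁}

/-- `α₀` exists. -/
def AlphaZeroExists : Prop := 1 ≤ S.G (S.h S.z) ∨ ∃ α₁, S.IsAlphaOne α₁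

/-- `J(β, a, b) = k ∫_a^b (1 - g'(x; β) / g'(b; β)) dx`, with the integral evaluated. -/
noncomputable def J (β a b : ℝ) : ℝ :=
  S.k * (b - a - (S.gb β b - S.gb β a) / S.dgb β b)

/-- `J₂(β) = J(β, u₂(β), u₃(β))`. -/
noncomputable def J₂ (β : ℝ) : ℝ := S.J β (S.u₂ β) (S.u₃ β)

/-- `J₁₃(β) = J(β, u₁(β), u₃(β))`. -/
noncomputable def J₁₃ (β : ℝ) : ℝ := S.J β (S.u₁ β) (S.u₃ β)

/-- `J₂(α₀)`, understood as a limit from the right, possibly infinite. -/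
noncomputable def J₂Start : EReal := limRight S.J₂ S.α₀

/-- `J₁₃(α₀)`, understood as a limit from the right, possibly infinite. -/
noncomputable def J₁₃Start : EReal := limRight S.J₁₃ S.α₀

def CaseG1 : Prop := 1 ≤ S.G (S.h S.z)

def CaseG2 : Prop := S.G (S.h S.z) < 1 ∧ S.AlphaZeroExists ∧ 0 ≤ S.J₁₃Start

def CaseG3 : Prop :=
  S.G (S.h S.z) < 1 ∧ S.AlphaZeroExists ∧ S.J₁₃Start < 0 ∧ (S.K : EReal) < S.J₂Start

end Data

end DividendProblem

/-!
The equation `L f = 0` enters through two facts. The Wronskian `W` of `g₁`, `g₂` is positive, and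
`P σ² f'' / 2`, with `P` the integrating factor, has derivative `P (lam - μ') f'` for every solution
`f`. The first makes `g₁' / g₂'` increasing, which gives the sign of `g₁'`; the second gives
`g₁'' > 0` on `[x1, ∞)`. The derivative of `h = g₂'' / g₁''` has the sign of `lam - μ'`, and
`g''(·; β) = g₁'' (h - β)`, so `g'(·; β)` decreases between `h_-^{-1}(β)` and `h_+^{-1}(β)` and is
nondecreasing afterwards.

The point `u₁(β)` is a zero of `Γ(β, x) = k g(x; β) - (k x - K) g'(x; β)`, which is affine in `β`.
Hence `u₁` is the inverse of an explicit function `b`, and `b' < 0` because of the sign of `q`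
(`Data.Problem.strictAntiOn_b`). That `ubar < x1` follows from the maximality of `cstar` together
with `c^∞ ≤ cstar` (`Data.Problem.ubar_lt_x1`).

Write `m(β) = g'(u₁(β); β)`. The key estimate (`Data.Problem.exists_factor`) is that
`g'(x; β) / m(β)` increases strictly with `β` for fixed `x > u₁(β)`: the functions
`k g(·; β) / m(β)` touch the line `k x - K` at `u₁(β)` and stay above it up to `z`, which orders
them at `u₁(β)` for two parameters, and `W > 0` makes the quotient of two of them increase
from there on, with the quotient of their derivatives exceeding it. Therefore `v < 1` and `G > 1` on
`(α₀, β₀)`, so `u₂` and `u₃` exist there, and at `β₀` the function `g'(·; β)` is nowhere below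
`m(β)` on `[xlam, ∞)`.

With the primitive `Ψ(β, ·)` of `k (1 - g'(·; β) / m(β))` vanishing at `u₁(β)` one has
`J₁₃ = Ψ(β, u₃)` and `J₂ = Ψ(β, u₃) - Ψ(β, u₂)`. Both are continuous on `(α₀, β₀)`; near `β₀`
one has `J₁₃ < 0` and `J₂ < K`; and `J₁₃` is nonincreasing, being the maximum of the decreasing
family `Ψ` over `[u₂, ∞)`. The first alternative of the conclusion says that `J₁₃ = 0` and `J₂ ≤ K`,
the second that `J₁₃ < 0` and `J₂ = K`, so the behaviour at `α₀` and the intermediate value theorem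
finish the proof (`Data.Problem.exists_parameter`).
-/

namespace DividendProblem

/-! ### Calculus on the half line -/

section Calculus

variable {f f' : ℝ → ℝ} {s : Set ℝ}

theorem strictMonoOn_of_hasDerivAt (hs : Convex ℝ s) (hc : ContinuousOn f s)
    (hd : ∀ x ∈ interior s, HasDerivAt f (f' x) x) (hp : ∀ x ∈ interior s, 0 < f' x) :
    StrictMonoOn f s :=
  strictMonoOn_of_hasDerivWithinAt_pos hs hc (fun x hx => (hd x hx).hasDerivWithinAt) hp

theorem strictAntiOn_of_hasDerivAt (hs : Convex ℝ s) (hc : ContinuousOn f s)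
    (hd : ∀ x ∈ interior s, HasDerivAt f (f' x) x) (hp : ∀ x ∈ interior s, f' x < 0) :
    StrictAntiOn f s :=
  strictAntiOn_of_hasDerivWithinAt_neg hs hc (fun x hx => (hd x hx).hasDerivWithinAt) hp

theorem monotoneOn_of_hasDerivAt (hs : Convex ℝ s) (hc : ContinuousOn f s)
    (hd : ∀ x ∈ interior s, HasDerivAt f (f' x) x) (hp : ∀ x ∈ interior s, 0 ≤ f' x) :
    MonotoneOn f s :=
  monotoneOn_of_hasDerivWithinAt_nonneg hs hc (fun x hx => (hd x hx).hasDerivWithinAt) hp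

theorem antitoneOn_of_hasDerivAt (hs : Convex ℝ s) (hc : ContinuousOn f s)
    (hd : ∀ x ∈ interior s, HasDerivAt f (f' x) x) (hp : ∀ x ∈ interior s, f' x ≤ 0) :
    AntitoneOn f s :=
  antitoneOn_of_hasDerivWithinAt_nonpos hs hc (fun x hx => (hd x hx).hasDerivWithinAt) hp

theorem hasDerivWithinAt_D (hf : ContDiffOn ℝ 1 f (Ici 0)) {x : ℝ} (hx : 0 ≤ x) :
    HasDerivWithinAt f (D f x) (Ici 0) x :=
  ((hf.differentiableOn one_ne_zero) x hx).hasDerivWithinAt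

theorem hasDerivAt_D (hf : ContDiffOn ℝ 1 f (Ici 0)) {x : ℝ} (hx : 0 < x) :
    HasDerivAt f (D f x) x :=
  (hasDerivWithinAt_D hf hx.le).hasDerivAt (Ici_mem_nhds hx)

theorem continuousOn_D (hf : ContDiffOn ℝ 1 f (Ici 0)) : ContinuousOn (D f) (Ici 0) :=
  hf.continuousOn_derivWithin (uniqueDiffOn_Ici 0) le_rfl

theorem contDiffOn_D (hf : ContDiffOn ℝ 2 f (Ici 0)) : ContDiffOn ℝ 1 (D f) (Ici 0) :=
  hf.derivWithin (uniqueDiffOn_Ici 0) (by norm_num)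

end Calculus

namespace Data

variable {S : Data} {x y β β' : ℝ}

/-! ### The homogeneous equation -/

/-- The integrating factor `exp (∫₀ˣ 2 μ / σ²)` of the equation; the coefficients are frozen at `0`
on the negative half line, which makes the factor differentiable on all of `ℝ`. -/
noncomputable def P (S : Data) (x : ℝ) : ℝ :=
  Real.exp (∫ t in (0 : ℝ)..x, 2 * S.μ (max t 0) / S.σ (max t 0) ^ 2)

/-- The Wronskian of `g₁` and `g₂`. -/
noncomputable def W (S : Data) (x : ℝ) : ℝ := S.g₁ x * D S.g₂ x - S.g₂ x * D S.g₁ x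

/-- For a solution `f`, this is `f''` times the positive weight `P σ² / 2`. -/
noncomputable def E (S : Data) (f : ℝ → ℝ) (x : ℝ) : ℝ :=
  S.P x * (S.lam * f x - S.μ x * D f x)

theorem P_pos (S : Data) (x : ℝ) : 0 < S.P x := Real.exp_pos _

theorem E_eq {f : ℝ → ℝ} (hf : IsSolution S.μ S.σ S.lam f) (hx : 0 ≤ x) :
    S.E f x = S.P x * (S.σ x ^ 2 / 2) * D (D f) x := by
  unfold E
  linear_combination -S.P x * hf.2 x hx

namespace Problem

variable (hS : S.Problem)
include hS

theorem c1_g₁ : ContDiffOn ℝ 1 S.g₁ (Ici 0) := hS.g₁_solution.1.of_le (by norm_num)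
theorem c1_g₂ : ContDiffOn ℝ 1 S.g₂ (Ici 0) := hS.g₂_solution.1.of_le (by norm_num)
theorem c1_dg₁ : ContDiffOn ℝ 1 (D S.g₁) (Ici 0) := contDiffOn_D hS.g₁_solution.1
theorem c1_dg₂ : ContDiffOn ℝ 1 (D S.g₂) (Ici 0) := contDiffOn_D hS.g₂_solution.1

theorem xlam_pos : 0 < S.xlam := hS.x1_pos.trans_le hS.x1_le

theorem ddg₁ (hx : 0 ≤ x) :
    S.σ x ^ 2 / 2 * D (D S.g₁) x = S.lam * S.g₁ x - S.μ x * D S.g₁ x := by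
  linarith [hS.g₁_solution.2 x hx]

theorem ddg₂ (hx : 0 ≤ x) :
    S.σ x ^ 2 / 2 * D (D S.g₂) x = S.lam * S.g₂ x - S.μ x * D S.g₂ x := by
  linarith [hS.g₂_solution.2 x hx]

theorem vol_ne_zero (hx : 0 ≤ x) : S.σ x ≠ 0 := fun h => by
  simpa [h] using hS.coefficients.vol_pos x hx

theorem hasDerivAt_P (hx : 0 ≤ x) :
    HasDerivAt S.P (S.P x * (2 * S.μ x / S.σ x ^ 2)) x := by
  have hmax : Continuous fun t : ℝ => max t 0 := by fun_prop
  have hmem : ∀ t : ℝ, max t 0 ∈ Ici (0 : ℝ) := fun t => mem_Ici.2 (le_max_right _ _)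
  have hμ : Continuous fun t : ℝ => S.μ (max t 0) :=
    hS.coefficients.contDiff_drift.continuousOn.comp_continuous hmax hmem
  have hσ : Continuous fun t : ℝ => S.σ (max t 0) :=
    hS.coefficients.contDiff_vol.continuousOn.comp_continuous hmax hmem
  have hc : Continuous fun t : ℝ => 2 * S.μ (max t 0) / S.σ (max t 0) ^ 2 :=
    (continuous_const.mul hμ).div (hσ.pow 2)
      fun t => (hS.coefficients.vol_pos _ (hmem t)).ne'
  have := (hc.integral_hasStrictDerivAt 0 x).hasDerivAt.exp
  simp only [max_eq_left hx] at this
  exact this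

theorem dg₂_pos (hx : 0 ≤ x) : 0 < D S.g₂ x := by
  rcases hx.eq_or_lt with rfl | hx0
  · exact hS.g₂_deriv
  have hnn : ∀ y, 0 ≤ D S.g₂ y := fun y => hS.g₂_strictMono.monotoneOn.derivWithin_nonneg
  refine (hnn x).lt_of_ne fun h0 => ?_
  -- at a zero `x`, `g₂'` has a minimum, so `g₂''(x) = 0`, and then the equation gives `g₂(x) = 0`
  have hmin : IsLocalMin (D S.g₂) x := Eventually.of_forall fun y => h0 ▸ hnn y
  have h2 := hmin.hasDerivAt_eq_zero (hasDerivAt_D hS.c1_dg₂ hx0)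
  have h3 := hS.ddg₂ hx
  rw [h2, ← h0] at h3
  have h4 := hS.g₂_strictMono (mem_Ici.2 le_rfl) (mem_Ici.2 hx) hx0
  rw [hS.g₂_zero] at h4
  have := mul_pos hS.coefficients.rate_pos (one_pos.trans h4)
  linarith

theorem g₂_ge_one (hx : 0 ≤ x) : 1 ≤ S.g₂ x :=
  hS.g₂_zero ▸ hS.g₂_strictMono.monotoneOn (mem_Ici.2 le_rfl) (mem_Ici.2 hx) hx

/-- The equation turns the Wronskian of `g₁'` and `g₂'` into that of `g₁` and `g₂`. -/
theorem wronskian_deriv_eq (hx : 0 ≤ x) :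
    S.σ x ^ 2 / 2 * (D (D S.g₁) x * D S.g₂ x - D S.g₁ x * D (D S.g₂) x) = S.lam * S.W x := by
  unfold W
  linear_combination D S.g₂ x * hS.ddg₁ hx - D S.g₁ x * hS.ddg₂ hx

theorem continuousOn_W : ContinuousOn S.W (Ici 0) :=
  (hS.c1_g₁.continuousOn.mul hS.c1_dg₂.continuousOn).sub
    (hS.c1_g₂.continuousOn.mul hS.c1_dg₁.continuousOn)

theorem hasDerivAt_W (hx : 0 < x) :
    HasDerivAt S.W (S.g₁ x * D (D S.g₂) x - S.g₂ x * D (D S.g₁) x) x := by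
  have := ((hasDerivAt_D hS.c1_g₁ hx).mul (hasDerivAt_D hS.c1_dg₂ hx)).sub
    ((hasDerivAt_D hS.c1_g₂ hx).mul (hasDerivAt_D hS.c1_dg₁ hx))
  exact this.congr_deriv (by ring)

theorem continuousOn_P : ContinuousOn S.P (Ici 0) := fun _ hx =>
  (hS.hasDerivAt_P hx).continuousAt.continuousWithinAt

theorem P_mul_W (hx : 0 ≤ x) : S.P x * S.W x = S.W 0 := by
  have hc : ContinuousOn (fun x => S.P x * S.W x) (Ici 0) :=
    hS.continuousOn_P.mul hS.continuousOn_W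
  have hd : ∀ y ∈ interior (Ici (0 : ℝ)), HasDerivAt (fun x => S.P x * S.W x) 0 y := by
    intro y hy
    rw [interior_Ici, mem_Ioi] at hy
    refine ((hS.hasDerivAt_P hy.le).mul (hS.hasDerivAt_W hy)).congr_deriv ?_
    have hσ := hS.vol_ne_zero hy.le
    have h1 := hS.ddg₁ hy.le
    have h2 := hS.ddg₂ hy.le
    unfold W
    field_simp
    linear_combination S.P y * (2 * S.g₁ y * h2 - 2 * S.g₂ y * h1)
  have h1 := monotoneOn_of_hasDerivAt (convex_Ici 0) hc hd (fun _ _ => le_rfl)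
    (mem_Ici.2 le_rfl) (mem_Ici.2 hx) hx
  have h2 := antitoneOn_of_hasDerivAt (convex_Ici 0) hc hd (fun _ _ => le_rfl)
    (mem_Ici.2 le_rfl) (mem_Ici.2 hx) hx
  have h3 : S.P 0 = 1 := by simp [P]
  simp only [h3, one_mul] at h1 h2
  exact le_antisymm h2 h1

theorem hasDerivAt_ratio (hx : 0 < x) :
    HasDerivAt (fun x => D S.g₁ x / D S.g₂ x)
      (S.lam * S.W x / (S.σ x ^ 2 / 2 * D S.g₂ x ^ 2)) x := by
  refine ((hasDerivAt_D hS.c1_dg₁ hx).div (hasDerivAt_D hS.c1_dg₂ hx)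
    (hS.dg₂_pos hx.le).ne').congr_deriv ?_
  have := (hS.dg₂_pos hx.le).ne'
  have hσ := hS.vol_ne_zero hx.le
  rw [← hS.wronskian_deriv_eq hx.le]
  field_simp

theorem continuousOn_ratio : ContinuousOn (fun x => D S.g₁ x / D S.g₂ x) (Ici 0) :=
  hS.c1_dg₁.continuousOn.div hS.c1_dg₂.continuousOn fun _ hx => (hS.dg₂_pos hx).ne'

theorem W_zero_pos : 0 < S.W 0 := by
  by_contra! hW
  -- otherwise `g₁' / g₂'` is nonincreasing, so `g₁` increases up to its critical point `xlam`
  have hWx : ∀ y, 0 ≤ y → S.W y ≤ 0 := fun y hy => by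
    have := hS.P_mul_W hy
    by_contra! h
    nlinarith [mul_pos (S.P_pos y) h]
  have hanti := antitoneOn_of_hasDerivAt (convex_Ici 0) hS.continuousOn_ratio
    (fun y hy => hS.hasDerivAt_ratio (by simpa using hy)) (fun y hy => by
      have hy' : 0 < y := by simpa using hy
      exact div_nonpos_of_nonpos_of_nonneg
        (mul_nonpos_of_nonneg_of_nonpos hS.coefficients.rate_pos.le (hWx y hy'.le))
        (by positivity))
  have hl := hS.xlam_pos
  have hnn : ∀ y ∈ Icc 0 S.xlam, 0 ≤ D S.g₁ y := fun y hy => by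
    have h1 := hanti (mem_Ici.2 hy.1) (mem_Ici.2 hl.le) hy.2
    simp only [hS.g₁_deriv, zero_div] at h1
    by_contra! h
    linarith [div_neg_of_neg_of_pos h (hS.dg₂_pos hy.1)]
  have hmono := monotoneOn_of_hasDerivAt (convex_Icc 0 S.xlam)
    (hS.c1_g₁.continuousOn.mono Icc_subset_Ici_self)
    (fun y hy => hasDerivAt_D hS.c1_g₁ (by rw [interior_Icc] at hy; exact hy.1))
    (fun y hy => hnn y (interior_subset hy))
  have h1 := hmono (left_mem_Icc.2 hl.le) (right_mem_Icc.2 hl.le) hl.le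
  rw [hS.g₁_zero] at h1
  have h2 := hWx S.xlam hl.le
  rw [W, hS.g₁_deriv] at h2
  nlinarith [hS.dg₂_pos hl.le]

theorem W_pos (hx : 0 ≤ x) : 0 < S.W x := by
  have h1 := hS.P_mul_W hx
  have h2 := hS.W_zero_pos
  rw [← h1] at h2
  exact pos_of_mul_pos_right h2 (S.P_pos x).le

theorem strictMonoOn_ratio : StrictMonoOn (fun x => D S.g₁ x / D S.g₂ x) (Ici 0) :=
  strictMonoOn_of_hasDerivAt (convex_Ici 0) hS.continuousOn_ratio
    (fun y hy => hS.hasDerivAt_ratio (by simpa using hy)) (fun y hy => by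
      have hy' : 0 < y := by simpa using hy
      have h1 := hS.W_pos hy'.le
      have h2 := hS.coefficients.rate_pos
      have h3 := hS.dg₂_pos hy'.le
      have h4 := hS.coefficients.vol_pos y hy'.le
      positivity)

theorem dg₁_neg (hx : 0 ≤ x) (hxl : x < S.xlam) : D S.g₁ x < 0 := by
  have h1 := hS.strictMonoOn_ratio (mem_Ici.2 hx) (mem_Ici.2 hS.xlam_pos.le) hxl
  simp only [hS.g₁_deriv, zero_div] at h1
  by_contra! h
  linarith [div_nonneg h (hS.dg₂_pos hx).le]

theorem dg₁_nonneg (hxl : S.xlam ≤ x) : 0 ≤ D S.g₁ x := by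
  have hx := hS.xlam_pos.le.trans hxl
  have h1 := hS.strictMonoOn_ratio.monotoneOn (mem_Ici.2 hS.xlam_pos.le) (mem_Ici.2 hx) hxl
  simp only [hS.g₁_deriv, zero_div] at h1
  by_contra! h
  linarith [div_neg_of_neg_of_pos h (hS.dg₂_pos hx)]

theorem dg₁_nonpos (hx : 0 ≤ x) (hxl : x ≤ S.xlam) : D S.g₁ x ≤ 0 := by
  rcases hxl.eq_or_lt with rfl | h
  · exact hS.g₁_deriv.le
  · exact (hS.dg₁_neg hx h).le

theorem g₁_pos (hx : 0 ≤ x) : 0 < S.g₁ x := by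
  have hl := hS.xlam_pos
  have hW := fun {y} (hy : 0 ≤ y) => hS.W_pos hy
  rcases le_total S.xlam x with h | h
  · have h1 := hS.W_pos hx
    have h2 := hS.dg₂_pos hx
    have h3 := mul_nonneg (zero_le_one.trans (hS.g₂_ge_one hx)) (hS.dg₁_nonneg h)
    rw [W] at h1
    exact pos_of_mul_pos_left (by linarith) h2.le
  · have hanti := antitoneOn_of_hasDerivAt (convex_Icc 0 S.xlam)
      (hS.c1_g₁.continuousOn.mono Icc_subset_Ici_self)
      (fun y hy => hasDerivAt_D hS.c1_g₁ (by rw [interior_Icc] at hy; exact hy.1))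
      (fun y hy => hS.dg₁_nonpos (interior_subset hy).1 (interior_subset hy).2)
    have h1 := hS.W_pos hl.le
    rw [W, hS.g₁_deriv, mul_zero, sub_zero] at h1
    exact (pos_of_mul_pos_left h1 (hS.dg₂_pos hl.le).le).trans_le
      (hanti ⟨hx, h⟩ ⟨hl.le, le_rfl⟩ h)

/-! ### Second derivatives -/

/-- Multiplication by the integrating factor cancels the term with `f''` that differentiating the
equation produces. -/
theorem hasDerivAt_E {f : ℝ → ℝ} (hf : IsSolution S.μ S.σ S.lam f) (hx : 0 < x) :
    HasDerivAt (S.E f) (S.P x * ((S.lam - D S.μ x) * D f x)) x := by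
  have h1 := hasDerivAt_D (hf.1.of_le (by norm_num)) hx
  have h2 := hasDerivAt_D (contDiffOn_D hf.1) hx
  have h3 := hasDerivAt_D hS.coefficients.contDiff_drift hx
  refine ((hS.hasDerivAt_P hx.le).mul ((h1.const_mul S.lam).sub (h3.mul h2))).congr_deriv ?_
  have hσ := hS.vol_ne_zero hx.le
  have h4 := hf.2 x hx.le
  simp only [Pi.mul_apply, Pi.sub_apply]
  field_simp
  linear_combination -2 * S.P x * S.μ x * h4

theorem continuousOn_E {f : ℝ → ℝ} (hf : IsSolution S.μ S.σ S.lam f) :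
    ContinuousOn (S.E f) (Ici 0) :=
  hS.continuousOn_P.mul ((continuousOn_const.mul hf.1.continuousOn).sub
    (hS.coefficients.contDiff_drift.continuousOn.mul (contDiffOn_D hf.1).continuousOn))

/-- The positive factor relating `E f` to `f''`. -/
theorem weight_pos (hx : 0 ≤ x) : 0 < S.P x * (S.σ x ^ 2 / 2) :=
  mul_pos (S.P_pos x) (half_pos (hS.coefficients.vol_pos x hx))

end Problem

/-- `g''(x; β)`. -/
noncomputable def ddgb (S : Data) (β x : ℝ) : ℝ := D (D S.g₂) x - β * D (D S.g₁) x

theorem g_eq_gb_one (S : Data) : S.g = S.gb 1 := by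
  funext x
  simp [g, gb]

namespace Problem

variable (hS : S.Problem)
include hS

theorem dgb_eq (hx : 0 ≤ x) : S.dgb β x = D S.g₂ x - β * D S.g₁ x :=
  ((hasDerivWithinAt_D hS.c1_g₂ hx).sub ((hasDerivWithinAt_D hS.c1_g₁ hx).const_mul β)).derivWithin
    (uniqueDiffOn_Ici 0 x hx)

theorem hasDerivAt_gb (hx : 0 < x) : HasDerivAt (S.gb β) (S.dgb β x) x := by
  rw [hS.dgb_eq hx.le]
  exact (hasDerivAt_D hS.c1_g₂ hx).sub ((hasDerivAt_D hS.c1_g₁ hx).const_mul β)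

theorem hasDerivAt_dgb (hx : 0 < x) : HasDerivAt (S.dgb β) (S.ddgb β x) x :=
  ((hasDerivAt_D hS.c1_dg₂ hx).sub ((hasDerivAt_D hS.c1_dg₁ hx).const_mul β)).congr_of_eventuallyEq
    (by filter_upwards [Ioi_mem_nhds hx] with y hy using hS.dgb_eq (le_of_lt hy))

theorem continuousOn_gb : ContinuousOn (S.gb β) (Ici 0) :=
  hS.c1_g₂.continuousOn.sub (continuousOn_const.mul hS.c1_g₁.continuousOn)

theorem continuousOn_dgb : ContinuousOn (S.dgb β) (Ici 0) :=
  (hS.c1_dg₂.continuousOn.sub (continuousOn_const.mul hS.c1_dg₁.continuousOn)).congr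
    fun _ hy => hS.dgb_eq hy

theorem ddgb_eq (hx : 0 ≤ x) :
    S.σ x ^ 2 / 2 * S.ddgb β x = S.lam * S.gb β x - S.μ x * S.dgb β x := by
  rw [hS.dgb_eq hx]
  unfold ddgb gb
  linear_combination hS.ddg₂ hx - β * hS.ddg₁ hx

theorem weight_mul_ddgb (hx : 0 ≤ x) :
    S.P x * (S.σ x ^ 2 / 2) * S.ddgb β x = S.E S.g₂ x - β * S.E S.g₁ x := by
  rw [E_eq hS.g₂_solution hx, E_eq hS.g₁_solution hx, ddgb]
  ring

theorem continuousOn_ddgb : ContinuousOn (S.ddgb β) (Ici 0) :=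
  (continuousOn_D hS.c1_dg₂).sub (continuousOn_const.mul (continuousOn_D hS.c1_dg₁))

theorem ddgb_one_nonneg (hx : 0 < x) (hx1 : x < S.x1) : 0 ≤ S.ddgb 1 x := by
  have hconv : ConvexOn ℝ (Ioo 0 S.x1) (S.gb 1) :=
    S.g_eq_gb_one ▸ hS.convex.subset Ioo_subset_Ico_self (convex_Ioo _ _)
  have hmono : MonotoneOn (S.dgb 1) (Ioo 0 S.x1) :=
    (hconv.monotoneOn_deriv fun y hy => (hS.hasDerivAt_gb hy.1).differentiableAt).congr
      fun y hy => (hS.hasDerivAt_gb hy.1).deriv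
  have := hmono.derivWithin_nonneg (x := x)
  rwa [(hS.hasDerivAt_dgb hx).hasDerivWithinAt.derivWithin
    (isOpen_Ioo.uniqueDiffWithinAt ⟨hx, hx1⟩)] at this

theorem ddgb_one_nonpos_of_lt (hx1 : S.x1 < x) : S.ddgb 1 x ≤ 0 := by
  have hconc : ConcaveOn ℝ (Ioi S.x1) (S.gb 1) :=
    S.g_eq_gb_one ▸ hS.concave.subset Ioi_subset_Ici_self (convex_Ioi _)
  have h0 : ∀ {y}, S.x1 < y → 0 < y := fun hy => hS.x1_pos.trans hy
  have hanti : AntitoneOn (S.dgb 1) (Ioi S.x1) :=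
    (hconc.antitoneOn_deriv fun y hy => (hS.hasDerivAt_gb (h0 hy)).differentiableAt).congr
      fun y hy => (hS.hasDerivAt_gb (h0 hy)).deriv
  have := hanti.derivWithin_nonpos (x := x)
  rwa [(hS.hasDerivAt_dgb (h0 hx1)).hasDerivWithinAt.derivWithin
    (isOpen_Ioi.uniqueDiffWithinAt hx1)] at this

theorem ddgb_one_x1 : S.ddgb 1 S.x1 = 0 := by
  have hc : ContinuousAt (S.ddgb 1) S.x1 :=
    hS.continuousOn_ddgb.continuousAt (Ici_mem_nhds hS.x1_pos)
  apply le_antisymm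
  · refine le_of_tendsto (hc.tendsto.mono_left nhdsWithin_le_nhds : Tendsto _ (𝓝[>] S.x1) _) ?_
    filter_upwards [self_mem_nhdsWithin] with y hy using hS.ddgb_one_nonpos_of_lt hy
  · refine ge_of_tendsto (hc.tendsto.mono_left nhdsWithin_le_nhds : Tendsto _ (𝓝[<] S.x1) _) ?_
    filter_upwards [Ioo_mem_nhdsLT hS.x1_pos] with y hy using hS.ddgb_one_nonneg hy.1 hy.2

theorem ddgb_one_nonpos (hx1 : S.x1 ≤ x) : S.ddgb 1 x ≤ 0 := by
  rcases hx1.eq_or_lt with rfl | h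
  · exact hS.ddgb_one_x1.le
  · exact hS.ddgb_one_nonpos_of_lt h

theorem dgb_one_pos_of_le_xlam (hx : 0 ≤ x) (hxl : x ≤ S.xlam) : 0 < S.dgb 1 x := by
  rw [hS.dgb_eq hx]
  linarith [hS.dg₂_pos hx, hS.dg₁_nonpos hx hxl]

theorem gb_pos (hβ : β ≤ 1) (h : 0 < S.gb 1 x) (hx : 0 ≤ x) : 0 < S.gb β x := by
  have := mul_nonneg (sub_nonneg.2 hβ) (hS.g₁_pos hx).le
  unfold gb at *
  linarith

/-- Where `g'(·; β) > 0` before `xlam`, the weighted second derivative of `g(·; β)` is strictly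
decreasing. -/
theorem strictAntiOn_E {a : ℝ} (ha : 0 ≤ a) (hp : ∀ x, a < x → x < S.xlam → 0 < S.dgb β x) :
    StrictAntiOn (fun x => S.E S.g₂ x - β * S.E S.g₁ x) (Icc a S.xlam) := by
  have hsub : Icc a S.xlam ⊆ Ici 0 := fun y hy => ha.trans hy.1
  refine strictAntiOn_of_hasDerivAt (convex_Icc _ _)
    (((hS.continuousOn_E hS.g₂_solution).sub
      (continuousOn_const.mul (hS.continuousOn_E hS.g₁_solution))).mono hsub)
    (f' := fun x => S.P x * ((S.lam - D S.μ x) * S.dgb β x)) ?_ ?_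
  · intro y hy
    rw [interior_Icc] at hy
    have hy0 := ha.trans_lt hy.1
    refine ((hS.hasDerivAt_E hS.g₂_solution hy0).sub
      ((hS.hasDerivAt_E hS.g₁_solution hy0).const_mul β)).congr_deriv ?_
    rw [hS.dgb_eq hy0.le]
    ring
  · intro y hy
    rw [interior_Icc] at hy
    have h1 := hS.coefficients.deriv_drift_gt y (ha.trans hy.1.le) hy.2
    exact mul_neg_of_pos_of_neg (S.P_pos y) (mul_neg_of_neg_of_pos (by linarith)
      (hp y hy.1 hy.2))

theorem ddgb_one_neg (hx1 : S.x1 < x) (hxl : x ≤ S.xlam) : S.ddgb 1 x < 0 := by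
  have h1 := hS.x1_pos
  have := hS.strictAntiOn_E h1.le (fun y hy hyl => hS.dgb_one_pos_of_le_xlam (h1.trans hy).le hyl.le)
    ⟨le_rfl, hx1.le.trans hxl⟩ ⟨hx1.le, hxl⟩ hx1
  simp only [← hS.weight_mul_ddgb h1.le, ← hS.weight_mul_ddgb (h1.trans hx1).le,
    hS.ddgb_one_x1, mul_zero] at this
  exact neg_of_mul_neg_right this (hS.weight_pos (h1.trans hx1).le).le

theorem ddgb_one_pos (hx : 0 < x) (hx1 : x < S.x1) : 0 < S.ddgb 1 x := by
  have := hS.strictAntiOn_E hx.le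
    (fun y hy hyl => hS.dgb_one_pos_of_le_xlam (hx.trans hy).le hyl.le)
    ⟨le_rfl, hx1.le.trans hS.x1_le⟩ ⟨hx1.le, hS.x1_le⟩ hx1
  simp only [← hS.weight_mul_ddgb hx.le, ← hS.weight_mul_ddgb hS.x1_pos.le,
    hS.ddgb_one_x1, mul_zero] at this
  exact pos_of_mul_pos_right this (hS.weight_pos hx.le).le

theorem ddg₁_x1_pos : 0 < D (D S.g₁) S.x1 := by
  have h0 := hS.x1_pos.le
  have h1 : D (D S.g₂) S.x1 = D (D S.g₁) S.x1 := by
    have := hS.ddgb_one_x1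
    unfold ddgb at this
    linarith
  by_contra! h
  -- `g₁''(x1) ≤ 0` forces `μ(x1) < 0`, which makes `g₂''(x1)` positive
  have hσ := hS.coefficients.vol_pos _ h0
  have h2 := hS.ddg₁ h0
  have h3 := hS.ddg₂ h0
  rw [h1] at h3
  have h4 := mul_nonpos_of_nonneg_of_nonpos (half_pos hσ).le h
  have h5 := mul_pos hS.coefficients.rate_pos (hS.g₁_pos h0)
  have h6 := hS.dg₁_nonpos h0 hS.x1_le
  have h7 := mul_pos hS.coefficients.rate_pos (zero_lt_one.trans_le (hS.g₂_ge_one h0))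
  have h8 := hS.dg₂_pos h0
  have h9 : S.μ S.x1 < 0 := by
    by_contra! hμ
    linarith [mul_nonpos_of_nonneg_of_nonpos hμ h6]
  linarith [mul_neg_of_neg_of_pos h9 h8]

theorem monotoneOn_E₁ : MonotoneOn (S.E S.g₁) (Ici 0) := by
  refine monotoneOn_of_hasDerivAt (convex_Ici 0) (hS.continuousOn_E hS.g₁_solution)
    (fun y hy => hS.hasDerivAt_E hS.g₁_solution (by simpa using hy)) fun y hy => ?_
  have hy0 : 0 < y := by simpa using hy
  refine mul_nonneg (S.P_pos y).le ?_
  rcases lt_or_ge y S.xlam with h | h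
  · exact mul_nonneg_of_nonpos_of_nonpos
      (by linarith [hS.coefficients.deriv_drift_gt y hy0.le h]) (hS.dg₁_neg hy0.le h).le
  · exact mul_nonneg (by linarith [hS.coefficients.deriv_drift_le y h]) (hS.dg₁_nonneg h)

theorem E₁_pos (hx1 : S.x1 ≤ x) : 0 < S.E S.g₁ x := by
  have h0 := hS.x1_pos.le
  have h1 := hS.monotoneOn_E₁ (mem_Ici.2 h0) (mem_Ici.2 (h0.trans hx1)) hx1
  refine lt_of_lt_of_le ?_ h1
  rw [E_eq hS.g₁_solution h0]
  exact mul_pos (hS.weight_pos h0) hS.ddg₁_x1_pos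

theorem ddg₁_pos (hx1 : S.x1 ≤ x) : 0 < D (D S.g₁) x := by
  have h0 := hS.x1_pos.le.trans hx1
  have h1 := hS.E₁_pos hx1
  rw [E_eq hS.g₁_solution h0] at h1
  exact pos_of_mul_pos_right h1 (hS.weight_pos h0).le

/-! ### The function `h` -/

theorem ddgb_eq_mul (hx1 : S.x1 ≤ x) : S.ddgb β x = D (D S.g₁) x * (S.h x - β) := by
  have := (hS.ddg₁_pos hx1).ne'
  unfold ddgb h
  field_simp

theorem h_eq (hx1 : S.x1 ≤ x) : S.h x = S.E S.g₂ x / S.E S.g₁ x := by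
  have h0 := hS.x1_pos.le.trans hx1
  rw [E_eq hS.g₁_solution h0, E_eq hS.g₂_solution h0,
    mul_div_mul_left _ _ (hS.weight_pos h0).ne', h]

theorem continuousOn_h : ContinuousOn S.h (Ici S.x1) := by
  have hsub : Ici S.x1 ⊆ Ici 0 := Ici_subset_Ici.2 hS.x1_pos.le
  exact ((continuousOn_D hS.c1_dg₂).mono hsub).div ((continuousOn_D hS.c1_dg₁).mono hsub)
    fun y hy => (hS.ddg₁_pos hy).ne'

/-- The numerator of `h'` is the Wronskian up to positive factors and the factor `lam - μ'`. -/
theorem hasDerivAt_h (hx1 : S.x1 < x) :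
    HasDerivAt S.h ((S.lam - D S.μ x) * (S.P x ^ 2 * S.lam * S.W x / S.E S.g₁ x ^ 2)) x := by
  have h0 := hS.x1_pos.trans hx1
  have h1 := (hS.E₁_pos hx1.le).ne'
  refine (((hS.hasDerivAt_E hS.g₂_solution h0).div
    (hS.hasDerivAt_E hS.g₁_solution h0) h1).congr_deriv ?_).congr_of_eventuallyEq ?_
  · field_simp
    unfold E W
    ring
  · filter_upwards [Ioi_mem_nhds hx1] with y hy using hS.h_eq (le_of_lt hy)

theorem h_factor_pos (hx1 : S.x1 ≤ x) : 0 < S.P x ^ 2 * S.lam * S.W x / S.E S.g₁ x ^ 2 := by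
  have h1 := hS.E₁_pos hx1
  have h2 := hS.W_pos (hS.x1_pos.le.trans hx1)
  have h3 := hS.coefficients.rate_pos
  have h4 := S.P_pos x
  positivity

theorem strictAntiOn_h : StrictAntiOn S.h (Icc S.x1 S.xlam) := by
  refine strictAntiOn_of_hasDerivAt (convex_Icc _ _) (hS.continuousOn_h.mono Icc_subset_Ici_self)
    (fun y hy => hS.hasDerivAt_h (by rw [interior_Icc] at hy; exact hy.1)) fun y hy => ?_
  rw [interior_Icc] at hy
  exact mul_neg_of_neg_of_pos (by
    linarith [hS.coefficients.deriv_drift_gt y (hS.x1_pos.trans hy.1).le hy.2])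
    (hS.h_factor_pos hy.1.le)

theorem monotoneOn_h : MonotoneOn S.h (Ici S.xlam) := by
  have hsub : Ici S.xlam ⊆ Ici S.x1 := Ici_subset_Ici.2 hS.x1_le
  refine monotoneOn_of_hasDerivAt (convex_Ici _) (hS.continuousOn_h.mono hsub)
    (fun y hy => hS.hasDerivAt_h ?_) fun y hy => ?_
  · rw [interior_Ici] at hy
    exact hS.x1_le.trans_lt hy
  · rw [interior_Ici] at hy
    exact mul_nonneg (sub_nonneg.2 (hS.coefficients.deriv_drift_le y (le_of_lt hy)))
      (hS.h_factor_pos (hS.x1_le.trans (le_of_lt hy))).le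

theorem h_x1 : S.h S.x1 = 1 := by
  have h1 := hS.ddgb_eq_mul (β := 1) le_rfl
  rw [hS.ddgb_one_x1] at h1
  linarith [(mul_eq_zero.1 h1.symm).resolve_left hS.ddg₁_x1_pos.ne']

/-- `h_∞` is an upper bound of `h` on `[xlam, ∞)`. -/
theorem h_le_hInf (hxl : S.xlam ≤ x) : (S.h x : EReal) ≤ S.hInf := by
  refine le_limsup_of_frequently_le (Eventually.frequently ?_)
  filter_upwards [eventually_ge_atTop x] with y hy
  exact EReal.coe_le_coe_iff.2 (hS.monotoneOn_h hxl (hxl.trans hy) hy)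

end Problem

theorem exists_lt_h_of_lt_hInf (hβ : (β : EReal) < S.hInf) (a : ℝ) : ∃ x, a ≤ x ∧ β < S.h x := by
  obtain ⟨x, hx, hax⟩ := ((frequently_lt_of_lt_limsup (by isBoundedDefault) hβ).and_eventually
    (eventually_ge_atTop a)).exists
  exact ⟨x, hax, EReal.coe_lt_coe_iff.1 hx⟩

/-! ### The tangent pair and the point `z` -/

/-- `Γ(β, x) = k g(x; β) - (k x - K) g'(x; β)`, which is `γ(β, x) g'(x; β)` without the
singularities at the zeros of `g'(·; β)`. -/
noncomputable def Γ (S : Data) (β x : ℝ) : ℝ := S.k * S.gb β x - (S.k * x - S.K) * S.dgb β x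

namespace Problem

variable (hS : S.Problem)
include hS

/-- The condition `c^∞ ≤ cstar`, combined with the monotonicity of `g'` on `[x1, ∞)`. -/
theorem k_le_cstar_mul (hx1 : S.x1 ≤ x) : S.k ≤ S.cstar * S.dgb 1 x := by
  have hc := hS.tangent.1
  have hanti : AntitoneOn (S.dgb 1) (Ici S.x1) :=
    antitoneOn_of_hasDerivAt (convex_Ici _)
      (hS.continuousOn_dgb.mono (Ici_subset_Ici.2 hS.x1_pos.le))
      (fun y hy => hS.hasDerivAt_dgb (hS.x1_pos.trans (by simpa using hy)))
      (fun y hy => hS.ddgb_one_nonpos (interior_subset hy))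
  have h1 : limInfty (D S.g) ≤ (S.dgb 1 x : EReal) := by
    rw [g_eq_gb_one]
    refine limsup_le_of_le (by isBoundedDefault) ?_
    filter_upwards [eventually_ge_atTop x] with y hy
    exact EReal.coe_le_coe_iff.2 (hanti hx1 (hx1.trans hy) hy)
  have h2 : (limInfty (D S.g)).toENNReal ≤ ENNReal.ofReal (S.dgb 1 x) := by
    simpa using EReal.toENNReal_le_toENNReal h1
  have h3 : ENNReal.ofReal S.k ≤ ENNReal.ofReal S.cstar * (limInfty (D S.g)).toENNReal := by
    refine (ENNReal.div_le_iff_le_mul (Or.inr ENNReal.ofReal_ne_top) (Or.inr ?_)).1 hS.cInf_le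
    exact (ENNReal.ofReal_pos.2 hc).ne'
  have h4 := h3.trans (mul_le_mul_right h2 _)
  rw [← ENNReal.ofReal_mul hc.le] at h4
  rcases le_total (S.cstar * S.dgb 1 x) 0 with h | h
  · rw [ENNReal.ofReal_of_nonpos h] at h4
    exact absurd (ENNReal.ofReal_pos.2 hS.k_pos) (not_lt.2 h4)
  · exact (ENNReal.ofReal_le_ofReal_iff h).1 h4

theorem dgb_one_pos (hx : 0 ≤ x) : 0 < S.dgb 1 x := by
  rcases le_total x S.xlam with h | h
  · exact hS.dgb_one_pos_of_le_xlam hx h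
  · exact pos_of_mul_pos_right (hS.k_pos.trans_le (hS.k_le_cstar_mul (hS.x1_le.trans h)))
      hS.tangent.1.le

theorem gb_pos_of_le_one (hβ : β ≤ 1) (hx : 0 < x) : 0 < S.gb β x := by
  refine hS.gb_pos hβ ?_ hx.le
  have := strictMonoOn_of_hasDerivAt (convex_Ici 0) (hS.continuousOn_gb (β := 1))
    (fun y hy => hS.hasDerivAt_gb (by simpa using hy))
    (fun y hy => hS.dgb_one_pos (interior_subset hy)) (mem_Ici.2 le_rfl) (mem_Ici.2 hx.le) hx
  simpa [gb, hS.g₁_zero, hS.g₂_zero] using this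

theorem dgb_pos_of_xlam_le (hβ : β ≤ 1) (hxl : S.xlam ≤ x) : 0 < S.dgb β x := by
  have h0 := hS.xlam_pos.le.trans hxl
  have h1 := hS.dgb_one_pos h0
  rw [hS.dgb_eq h0] at *
  nlinarith [hS.dg₁_nonneg hxl]

theorem hasDerivAt_Γ (hx : 0 < x) : HasDerivAt (S.Γ β) (-((S.k * x - S.K) * S.ddgb β x)) x := by
  have h1 : HasDerivAt (fun x => S.k * x - S.K) S.k x := by
    simpa using ((hasDerivAt_id x).const_mul S.k).sub_const S.K
  exact (((hS.hasDerivAt_gb hx).const_mul S.k).sub (h1.mul (hS.hasDerivAt_dgb hx))).congr_deriv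
    (by ring)

theorem continuousOn_Γ : ContinuousOn (S.Γ β) (Ici 0) :=
  (continuousOn_const.mul hS.continuousOn_gb).sub
    (((continuousOn_const.mul continuousOn_id).sub continuousOn_const).mul hS.continuousOn_dgb)

/-- The equation expresses `Γ` through `q`; where `Γ = 0` and `q < 0 < g'`, it gives `g'' > 0`. -/
theorem lam_mul_Γ (hx : 0 ≤ x) :
    S.lam * S.Γ β x = S.q x * S.dgb β x + S.σ x ^ 2 / 2 * (S.k * S.ddgb β x) := by
  unfold Γ q
  linear_combination -S.k * hS.ddgb_eq (β := β) hx

theorem continuousOn_q : ContinuousOn S.q (Ici 0) :=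
  (hS.coefficients.contDiff_drift.continuousOn.mul continuousOn_const).sub
    (continuousOn_const.mul ((continuousOn_const.mul continuousOn_id).sub continuousOn_const))

theorem strictMonoOn_q : StrictMonoOn S.q (Icc 0 S.xlam) := by
  refine strictMonoOn_of_hasDerivAt (convex_Icc _ _) (hS.continuousOn_q.mono Icc_subset_Ici_self)
    (f' := fun x => D S.μ x * S.k - S.lam * S.k) ?_ ?_
  · intro y hy
    rw [interior_Icc] at hy
    have h1 : HasDerivAt (fun x => S.k * x - S.K) S.k y := by
      simpa using ((hasDerivAt_id y).const_mul S.k).sub_const S.K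
    exact ((hasDerivAt_D hS.coefficients.contDiff_drift hy.1).mul_const _).sub (h1.const_mul _)
  · intro y hy
    rw [interior_Icc] at hy
    nlinarith [hS.coefficients.deriv_drift_gt y hy.1.le hy.2, hS.k_pos]

theorem ubar_pos : 0 < S.ubar := hS.tangent.2.1

theorem cstar_mul_dgb : S.cstar * S.dgb 1 S.ubar = S.k := by
  have := hS.tangent.2.2.1
  rwa [g_eq_gb_one] at this

theorem Γ_one_ubar : S.Γ 1 S.ubar = 0 := by
  have h1 := hS.cstar_mul_dgb
  have h2 := hS.tangent.2.2.2
  rw [g_eq_gb_one] at h2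
  have h3 : S.cstar * S.Γ 1 S.ubar = 0 := by
    unfold Γ
    linear_combination S.k * h2 - (S.k * S.ubar - S.K) * h1
  exact (mul_eq_zero.1 h3).resolve_left hS.tangent.1.ne'

theorem payment_ubar_pos : 0 < S.k * S.ubar - S.K := by
  rw [← hS.tangent.2.2.2, g_eq_gb_one]
  exact mul_pos hS.tangent.1 (hS.gb_pos_of_le_one le_rfl hS.ubar_pos)

theorem payment_pos (hx : S.ubar ≤ x) : 0 < S.k * x - S.K := by
  have := mul_le_mul_of_nonneg_left hx hS.k_pos.le
  linarith [hS.payment_ubar_pos]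

theorem dgb_one_ubar_le (hx1 : S.x1 ≤ x) : S.dgb 1 S.ubar ≤ S.dgb 1 x := by
  have h1 := hS.k_le_cstar_mul hx1
  rw [← hS.cstar_mul_dgb] at h1
  exact le_of_mul_le_mul_left h1 hS.tangent.1

/-- If `ubar ≥ x1`, then `c^∞ ≤ cstar` makes `g` affine beyond `ubar`, and its tangent line there lies
strictly above `g` at `x1`. There is then a second contact point `u < x1`. Both tangents pass
through `(K / k, 0)` and the one at `u` is at least as steep by maximality of `cstar`, so `g` is on
or above the first line at `u`, and grows at least as fast as that line on `[u, x1]`. -/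
theorem ubar_lt_x1 : S.ubar < S.x1 := by
  by_contra! hle
  have hx1 := hS.x1_pos
  have hlam := hS.coefficients.rate_pos
  have hΓu := hS.Γ_one_ubar
  have hanti : AntitoneOn (S.dgb 1) (Ici S.x1) :=
    antitoneOn_of_hasDerivAt (convex_Ici _)
      (hS.continuousOn_dgb.mono (Ici_subset_Ici.2 hx1.le))
      (fun y hy => hS.hasDerivAt_dgb (hx1.trans (by simpa using hy)))
      (fun y hy => hS.ddgb_one_nonpos (interior_subset hy))
  have hconst : ∀ y, S.ubar ≤ y → S.dgb 1 y = S.dgb 1 S.ubar := fun y hy =>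
    le_antisymm (hanti hle (hle.trans hy) hy) (hS.dgb_one_ubar_le (hle.trans hy))
  have hdd : ∀ y, S.ubar < y → S.ddgb 1 y = 0 := fun y hy =>
    (hS.hasDerivAt_dgb (hS.ubar_pos.trans hy)).unique
      ((hasDerivAt_const y (S.dgb 1 S.ubar)).congr_of_eventuallyEq
        (by filter_upwards [Ioi_mem_nhds hy] with w hw using hconst w (le_of_lt hw)))
  have hddu : S.ddgb 1 S.ubar = 0 := by
    have hc : ContinuousAt (S.ddgb 1) S.ubar :=
      hS.continuousOn_ddgb.continuousAt (Ici_mem_nhds hS.ubar_pos)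
    refine tendsto_nhds_unique
      (hc.tendsto.mono_left nhdsWithin_le_nhds : Tendsto _ (𝓝[>] S.ubar) _)
      (tendsto_const_nhds.congr' ?_)
    filter_upwards [self_mem_nhdsWithin] with w hw using (hdd w hw).symm
  have hqu : S.q S.ubar = 0 := by
    have h1 := hS.lam_mul_Γ (β := 1) hS.ubar_pos.le
    rw [hΓu, hddu] at h1
    have h2 : S.q S.ubar * S.dgb 1 S.ubar = 0 := by linarith
    exact (mul_eq_zero.1 h2).resolve_right (hS.dgb_one_pos hS.ubar_pos.le).ne'
  have hul : S.xlam < S.ubar := by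
    rcases lt_trichotomy S.ubar S.xlam with h | h | h
    · exact absurd (hdd _ h) (hS.ddgb_one_neg (hle.trans_lt h) le_rfl).ne
    · exact absurd (h ▸ hqu) hS.q_xlam_pos.ne'
    · exact h
  have hΓ1 : S.lam * S.Γ 1 S.x1 = S.q S.x1 * S.dgb 1 S.x1 := by
    rw [hS.lam_mul_Γ hx1.le, hS.ddgb_one_x1]
    ring
  -- `Γ(1, ·)` is nondecreasing from `max x1 (K / k)` on
  have hmono : ∀ a, S.x1 ≤ a → 0 ≤ S.k * a - S.K → MonotoneOn (S.Γ 1) (Ici a) := fun a ha1 ha2 =>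
    monotoneOn_of_hasDerivAt (convex_Ici _)
      (hS.continuousOn_Γ.mono (Ici_subset_Ici.2 (hx1.le.trans ha1)))
      (fun y hy => hS.hasDerivAt_Γ (hx1.trans_le (ha1.trans (interior_subset hy))))
      (fun y hy => by
        have hy' : a ≤ y := interior_subset hy
        have h1 : 0 ≤ S.k * y - S.K := by
          linarith [mul_le_mul_of_nonneg_left hy' hS.k_pos.le]
        have h2 := hS.ddgb_one_nonpos (ha1.trans hy')
        linarith [mul_nonpos_of_nonneg_of_nonpos h1 h2])
  have hkK : S.k * (S.K / S.k) - S.K = 0 := by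
    have := hS.k_pos.ne'
    field_simp
    ring
  have hKk : 0 < S.K / S.k := div_pos hS.K_pos hS.k_pos
  have hΓK : 0 < S.Γ 1 (S.K / S.k) := by
    unfold Γ
    rw [hkK, zero_mul, sub_zero]
    exact mul_pos hS.k_pos (hS.gb_pos_of_le_one le_rfl hKk)
  have hKu : S.K / S.k < S.ubar := by
    rw [div_lt_iff₀ hS.k_pos]
    linarith [hS.payment_ubar_pos]
  have hKx1 : S.K / S.k < S.x1 := by
    by_contra! h
    have := hmono _ h hkK.ge (mem_Ici.2 le_rfl) (mem_Ici.2 hKu.le) hKu.le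
    linarith
  have hpx1 : 0 < S.k * S.x1 - S.K := by
    rw [div_lt_iff₀ hS.k_pos] at hKx1
    linarith
  have hΓx1 : S.Γ 1 S.x1 ≤ 0 := by
    have := hmono _ le_rfl hpx1.le (mem_Ici.2 le_rfl) (mem_Ici.2 hle) hle
    linarith
  have hlt : S.x1 < S.xlam := by
    refine hS.x1_le.lt_of_ne fun h => ?_
    have h1 := mul_pos hS.q_xlam_pos (hS.dgb_one_pos hS.xlam_pos.le)
    rw [← h, ← hΓ1] at h1
    linarith [mul_nonpos_of_nonneg_of_nonpos hlam.le hΓx1]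
  obtain ⟨u, hu, hu0⟩ := intermediate_value_Icc' hKx1.le
    (hS.continuousOn_Γ.mono fun y hy => hKk.le.trans hy.1) (show (0 : ℝ) ∈ _ from ⟨hΓx1, hΓK.le⟩)
  have hu1 : 0 < u := hKk.trans_le hu.1
  have hgu := hS.dgb_one_pos hu1.le
  have hgub := hS.dgb_one_pos hS.ubar_pos.le
  have hsteep : S.dgb 1 S.ubar ≤ S.dgb 1 u := by
    have h1 : S.k / S.dgb 1 u ≤ S.cstar := by
      refine hS.tangent_max _ u ⟨div_pos hS.k_pos hgu, hu1, ?_, ?_⟩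
      · rw [g_eq_gb_one]
        exact div_mul_cancel₀ _ hgu.ne'
      · rw [g_eq_gb_one, div_mul_eq_mul_div, div_eq_iff hgu.ne']
        unfold Γ at hu0
        linarith
    rw [div_le_iff₀ hgu] at h1
    exact le_of_mul_le_mul_left (hS.cstar_mul_dgb.trans_le h1) hS.tangent.1
  -- `s` is `g` minus the tangent line at `ubar`, as `g(ubar) = g'(ubar) (ubar - K / k)`
  set p := S.dgb 1 S.ubar with hp
  let s : ℝ → ℝ := fun x => S.gb 1 x - p * (x - S.K / S.k)
  have hsd : ∀ y, 0 < y → HasDerivAt s (S.dgb 1 y - p) y := fun y hy => by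
    have := (hS.hasDerivAt_gb (β := 1) hy).sub
      (((hasDerivAt_id y).sub_const (S.K / S.k)).const_mul p)
    rwa [mul_one] at this
  have hsc : ContinuousOn s (Ici 0) := hS.continuousOn_gb.sub (by fun_prop)
  have hΓs : ∀ y, S.k * S.gb 1 y = S.Γ 1 y + S.k * ((y - S.K / S.k) * S.dgb 1 y) := fun y => by
    have := hS.k_pos.ne'
    unfold Γ
    field_simp
    ring
  have hs1 : s S.ubar = 0 := by
    have h1 := hΓs S.ubar
    rw [hΓu, zero_add] at h1
    have h2 := mul_left_cancel₀ hS.k_pos.ne' h1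
    simp only [s, h2]
    ring
  have hs2 : 0 ≤ s u := by
    have h1 := hΓs u
    rw [hu0, zero_add] at h1
    have h2 := mul_left_cancel₀ hS.k_pos.ne' h1
    simp only [s, h2]
    have : 0 ≤ (u - S.K / S.k) * (S.dgb 1 u - p) :=
      mul_nonneg (sub_nonneg.2 hu.1) (sub_nonneg.2 hsteep)
    linarith
  have hs3 : s u ≤ s S.x1 := by
    have hm : MonotoneOn (S.dgb 1) (Icc u S.x1) :=
      monotoneOn_of_hasDerivAt (convex_Icc _ _)
        (hS.continuousOn_dgb.mono fun y hy => hu1.le.trans hy.1)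
        (fun y hy => hS.hasDerivAt_dgb (by rw [interior_Icc] at hy; exact hu1.trans hy.1))
        (fun y hy => by
          rw [interior_Icc] at hy
          exact hS.ddgb_one_nonneg (hu1.trans hy.1) hy.2)
    refine monotoneOn_of_hasDerivAt (convex_Icc u S.x1) (hsc.mono fun y hy => hu1.le.trans hy.1)
      (fun y hy => hsd y (by rw [interior_Icc] at hy; exact hu1.trans hy.1))
      (fun y hy => ?_) (left_mem_Icc.2 hu.2) (right_mem_Icc.2 hu.2) hu.2
    have hy' := interior_subset hy
    linarith [hm (left_mem_Icc.2 hu.2) hy' hy'.1]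
  have hs4 : s S.x1 < s S.xlam := by
    have hm : StrictAntiOn (S.dgb 1) (Icc S.x1 S.xlam) :=
      strictAntiOn_of_hasDerivAt (convex_Icc _ _)
        (hS.continuousOn_dgb.mono fun y hy => hx1.le.trans hy.1)
        (fun y hy => hS.hasDerivAt_dgb (by rw [interior_Icc] at hy; exact hx1.trans hy.1))
        (fun y hy => by
          rw [interior_Icc] at hy
          exact hS.ddgb_one_neg hy.1 hy.2.le)
    refine strictMonoOn_of_hasDerivAt (convex_Icc S.x1 S.xlam)
      (hsc.mono fun y hy => hx1.le.trans hy.1)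
      (fun y hy => hsd y (by rw [interior_Icc] at hy; exact hx1.trans hy.1))
      (fun y hy => ?_) (left_mem_Icc.2 hlt.le) (right_mem_Icc.2 hlt.le) hlt
    rw [interior_Icc] at hy
    linarith [hm ⟨hy.1.le, hy.2.le⟩ (right_mem_Icc.2 hlt.le) hy.2, hS.dgb_one_ubar_le hlt.le]
  have hs5 : s S.xlam ≤ s S.ubar := by
    have h0 := hS.xlam_pos
    refine monotoneOn_of_hasDerivAt (convex_Icc S.xlam S.ubar)
      (hsc.mono fun y hy => h0.le.trans hy.1)
      (fun y hy => hsd y (by rw [interior_Icc] at hy; exact h0.trans hy.1))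
      (fun y hy => ?_) (left_mem_Icc.2 hul.le) (right_mem_Icc.2 hul.le) hul.le
    have hy' := interior_subset hy
    linarith [hS.dgb_one_ubar_le (hlt.le.trans hy'.1)]
  linarith

theorem q_x1_neg : S.q S.x1 < 0 := by
  have h0 := hS.ubar_pos
  have h1 := hS.ubar_lt_x1
  have h2 : S.Γ 1 S.x1 < S.Γ 1 S.ubar := by
    refine strictAntiOn_of_hasDerivAt (convex_Icc S.ubar S.x1)
      (hS.continuousOn_Γ.mono fun y hy => h0.le.trans hy.1)
      (fun y hy => hS.hasDerivAt_Γ (by rw [interior_Icc] at hy; exact h0.trans hy.1))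
      (fun y hy => ?_) (left_mem_Icc.2 h1.le) (right_mem_Icc.2 h1.le) h1
    rw [interior_Icc] at hy
    exact neg_neg_of_pos
      (mul_pos (hS.payment_pos hy.1.le) (hS.ddgb_one_pos (h0.trans hy.1) hy.2))
  have h3 := hS.lam_mul_Γ (β := 1) hS.x1_pos.le
  rw [hS.ddgb_one_x1, mul_zero, mul_zero, add_zero] at h3
  rw [hS.Γ_one_ubar] at h2
  have h4 := mul_neg_of_pos_of_neg hS.coefficients.rate_pos h2
  rw [h3] at h4
  exact neg_of_mul_neg_left h4 (hS.dgb_one_pos hS.x1_pos.le).le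

theorem z_spec : S.z ∈ Ioo S.x1 S.xlam ∧ S.q S.z = 0 := by
  have h0 := hS.x1_pos.le
  obtain ⟨w, hw, hw0⟩ := intermediate_value_Ioo hS.x1_le
    (hS.continuousOn_q.mono fun y hy => h0.trans hy.1)
    (show (0 : ℝ) ∈ _ from ⟨hS.q_x1_neg, hS.q_xlam_pos⟩)
  have : {x | x ∈ Ioo S.x1 S.xlam ∧ S.q x = 0} = {w} := by
    ext y
    simp only [mem_ofPred_eq, mem_singleton_iff]
    refine ⟨fun hy => ?_, fun hy => hy ▸ ⟨hw, hw0⟩⟩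
    exact hS.strictMonoOn_q.injOn ⟨h0.trans hy.1.1.le, hy.1.2.le⟩ ⟨h0.trans hw.1.le, hw.2.le⟩
      (hy.2.trans hw0.symm)
  rw [z, this, csInf_singleton]
  exact ⟨hw, hw0⟩

theorem x1_lt_z : S.x1 < S.z := hS.z_spec.1.1
theorem z_lt_xlam : S.z < S.xlam := hS.z_spec.1.2
theorem ubar_lt_z : S.ubar < S.z := hS.ubar_lt_x1.trans hS.x1_lt_z
theorem z_pos : 0 < S.z := hS.x1_pos.trans hS.x1_lt_z

theorem q_neg (hx : 0 ≤ x) (hxz : x < S.z) : S.q x < 0 := by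
  rw [← hS.z_spec.2]
  exact hS.strictMonoOn_q ⟨hx, (hxz.trans hS.z_lt_xlam).le⟩ ⟨hS.z_pos.le, hS.z_lt_xlam.le⟩ hxz

theorem h_z_lt_one : S.h S.z < 1 := by
  have h := hS.strictAntiOn_h (left_mem_Icc.2 hS.x1_le) ⟨hS.x1_lt_z.le, hS.z_lt_xlam.le⟩ hS.x1_lt_z
  rwa [hS.h_x1] at h

end Problem

/-! ### The root `u₁` -/

/-- The parameter `β` for which `Γ(β, x) = 0`. -/
noncomputable def b (S : Data) (x : ℝ) : ℝ :=
  (S.k * S.g₂ x - (S.k * x - S.K) * D S.g₂ x) / (S.k * S.g₁ x - (S.k * x - S.K) * D S.g₁ x)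

/-- The slope `g'(u₁(β); β)`. -/
noncomputable def m (S : Data) (β : ℝ) : ℝ := S.dgb β (S.u₁ β)

theorem γ_mul_dgb (h : S.dgb β x ≠ 0) : S.γ β x * S.dgb β x = S.Γ β x := by
  unfold γ Γ
  field_simp
  ring

namespace Problem

variable (hS : S.Problem)
include hS

theorem b_denom_pos (hx : S.ubar ≤ x) (hxl : x ≤ S.xlam) :
    0 < S.k * S.g₁ x - (S.k * x - S.K) * D S.g₁ x := by
  have h0 := hS.ubar_pos.le.trans hx
  have h1 := mul_pos hS.k_pos (hS.g₁_pos h0)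
  linarith [mul_nonpos_of_nonneg_of_nonpos (hS.payment_pos hx).le (hS.dg₁_nonpos h0 hxl)]

theorem Γ_eq_zero_iff (hx : S.ubar ≤ x) (hxl : x ≤ S.xlam) : S.Γ β x = 0 ↔ S.b x = β := by
  have h0 := hS.ubar_pos.le.trans hx
  have h1 := hS.b_denom_pos hx hxl
  rw [b, div_eq_iff h1.ne', Γ, hS.dgb_eq h0, gb]
  constructor <;> intro h <;> linarith

theorem continuousOn_payment_diff {f : ℝ → ℝ} (hf : ContDiffOn ℝ 1 f (Ici 0)) :
    ContinuousOn (fun x => S.k * f x - (S.k * x - S.K) * D f x) (Icc S.ubar S.z) := by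
  have hsub : Icc S.ubar S.z ⊆ Ici 0 := fun y hy => hS.ubar_pos.le.trans hy.1
  exact (continuousOn_const.mul (hf.continuousOn.mono hsub)).sub
    ((by fun_prop : ContinuousOn (fun x => S.k * x - S.K) _).mul ((continuousOn_D hf).mono hsub))

theorem continuousOn_b : ContinuousOn S.b (Icc S.ubar S.z) :=
  (hS.continuousOn_payment_diff hS.c1_g₂).div (hS.continuousOn_payment_diff hS.c1_g₁)
    fun _ hy => (hS.b_denom_pos hy.1 (hy.2.trans hS.z_lt_xlam.le)).ne'

/-- By the equation, the numerator of `b'` is the Wronskian times `q`, up to a positive factor, and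
`q < 0` before `z`. -/
theorem strictAntiOn_b : StrictAntiOn S.b (Icc S.ubar S.z) := by
  have hpd : ∀ y, HasDerivAt (fun x => S.k * x - S.K) S.k y := fun y => by
    simpa using ((hasDerivAt_id y).const_mul S.k).sub_const S.K
  refine strictAntiOn_of_hasDerivAt (convex_Icc _ _) hS.continuousOn_b
    (f' := fun x => (S.k * x - S.K) * S.W x * S.q x /
      (S.σ x ^ 2 / 2 * (S.k * S.g₁ x - (S.k * x - S.K) * D S.g₁ x) ^ 2)) ?_ ?_
  · intro y hy
    rw [interior_Icc] at hy
    have h0 := hS.ubar_pos.trans hy.1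
    have hB := (hS.b_denom_pos hy.1.le (hy.2.trans hS.z_lt_xlam).le).ne'
    refine ((((hasDerivAt_D hS.c1_g₂ h0).const_mul S.k).sub
      ((hpd y).mul (hasDerivAt_D hS.c1_dg₂ h0))).div
      (((hasDerivAt_D hS.c1_g₁ h0).const_mul S.k).sub
      ((hpd y).mul (hasDerivAt_D hS.c1_dg₁ h0))) hB).congr_deriv ?_
    have hσ := hS.vol_ne_zero h0.le
    have h1 := hS.ddg₁ h0.le
    have h2 := hS.ddg₂ h0.le
    simp only [Pi.mul_apply, Pi.sub_apply]
    rw [div_eq_div_iff (pow_ne_zero 2 hB) (by positivity)]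
    unfold W q
    linear_combination
      (S.k * S.g₁ y - (S.k * y - S.K) * D S.g₁ y) ^ 2 * (S.k * y - S.K) *
      ((S.k * S.g₂ y - (S.k * y - S.K) * D S.g₂ y) * h1 -
        (S.k * S.g₁ y - (S.k * y - S.K) * D S.g₁ y) * h2)
  · intro y hy
    rw [interior_Icc] at hy
    have h0 := hS.ubar_pos.trans hy.1
    have hB := hS.b_denom_pos hy.1.le (hy.2.trans hS.z_lt_xlam).le
    have hσ := hS.coefficients.vol_pos y h0.le
    exact div_neg_of_neg_of_pos (mul_neg_of_pos_of_neg
      (mul_pos (hS.payment_pos hy.1.le) (hS.W_pos h0.le)) (hS.q_neg h0.le hy.2)) (by positivity)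

theorem b_ubar : S.b S.ubar = 1 :=
  (hS.Γ_eq_zero_iff le_rfl (hS.ubar_lt_z.trans hS.z_lt_xlam).le).1 hS.Γ_one_ubar

theorem b_z : S.b S.z = S.h S.z := by
  refine (hS.Γ_eq_zero_iff hS.ubar_lt_z.le hS.z_lt_xlam.le).1 ?_
  have h1 := hS.lam_mul_Γ (β := S.h S.z) hS.z_pos.le
  rw [hS.z_spec.2, hS.ddgb_eq_mul hS.x1_lt_z.le, sub_self] at h1
  have h2 : S.lam * S.Γ (S.h S.z) S.z = 0 := by linarith
  exact (mul_eq_zero.1 h2).resolve_left hS.coefficients.rate_pos.ne'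

theorem dgb_pos_of_Γ_eq_zero (hβ : β ≤ 1) (hx : S.ubar ≤ x) (h : S.Γ β x = 0) :
    0 < S.dgb β x := by
  have h1 := mul_pos hS.k_pos (hS.gb_pos_of_le_one hβ (hS.ubar_pos.trans_le hx))
  unfold Γ at h
  exact pos_of_mul_pos_right (show 0 < (S.k * x - S.K) * S.dgb β x by linarith)
    (hS.payment_pos hx).le

theorem u₁_spec (hβ : β ∈ Icc (S.h S.z) 1) :
    S.u₁ β ∈ Icc S.ubar S.z ∧ S.b (S.u₁ β) = β := by
  obtain ⟨u, hu, hub⟩ := intermediate_value_Icc' hS.ubar_lt_z.le hS.continuousOn_b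
    (show β ∈ _ by rwa [hS.b_ubar, hS.b_z])
  have hl : ∀ {y}, y ∈ Icc S.ubar S.z → y ≤ S.xlam := fun hy => hy.2.trans hS.z_lt_xlam.le
  have : {u | u ∈ Icc S.ubar S.z ∧ S.dgb β u ≠ 0 ∧ S.γ β u = 0} = {u} := by
    ext y
    simp only [mem_ofPred_eq, mem_singleton_iff]
    constructor
    · rintro ⟨hy, hy0, hyγ⟩
      have h1 : S.Γ β y = 0 := by rw [← γ_mul_dgb hy0, hyγ, zero_mul]
      exact hS.strictAntiOn_b.injOn hy hu (((hS.Γ_eq_zero_iff hy.1 (hl hy)).1 h1).trans hub.symm)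
    · rintro rfl
      have h1 := (hS.Γ_eq_zero_iff hu.1 (hl hu)).2 hub
      have h2 := (hS.dgb_pos_of_Γ_eq_zero hβ.2 hu.1 h1).ne'
      refine ⟨hu, h2, ?_⟩
      rw [← γ_mul_dgb h2] at h1
      exact (mul_eq_zero.1 h1).resolve_right h2
  rw [u₁, this, csInf_singleton]
  exact ⟨hu, hub⟩

theorem u₁_pos (hβ : β ∈ Icc (S.h S.z) 1) : 0 < S.u₁ β :=
  hS.ubar_pos.trans_le (hS.u₁_spec hβ).1.1

theorem Γ_u₁ (hβ : β ∈ Icc (S.h S.z) 1) : S.Γ β (S.u₁ β) = 0 :=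
  have h := hS.u₁_spec hβ
  (hS.Γ_eq_zero_iff h.1.1 (h.1.2.trans hS.z_lt_xlam.le)).2 h.2

theorem m_pos (hβ : β ∈ Icc (S.h S.z) 1) : 0 < S.m β :=
  hS.dgb_pos_of_Γ_eq_zero hβ.2 (hS.u₁_spec hβ).1.1 (hS.Γ_u₁ hβ)

theorem γ_u₁ (hβ : β ∈ Icc (S.h S.z) 1) : S.γ β (S.u₁ β) = 0 := by
  have h1 := hS.Γ_u₁ hβ
  have h2 : S.dgb β (S.u₁ β) ≠ 0 := (hS.m_pos hβ).ne'
  rw [← γ_mul_dgb h2] at h1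
  exact (mul_eq_zero.1 h1).resolve_right h2

theorem k_mul_gb_u₁ (hβ : β ∈ Icc (S.h S.z) 1) :
    S.k * S.gb β (S.u₁ β) = (S.k * S.u₁ β - S.K) * S.m β := by
  have := hS.Γ_u₁ hβ
  unfold Γ at this
  unfold m
  linarith

theorem u₁_lt_u₁ {β' : ℝ} (hβ : β ∈ Icc (S.h S.z) 1) (hβ' : β' ∈ Icc (S.h S.z) 1)
    (h : β < β') : S.u₁ β' < S.u₁ β := by
  obtain ⟨h1, h2⟩ := hS.u₁_spec hβ
  obtain ⟨h3, h4⟩ := hS.u₁_spec hβ'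
  rwa [← hS.strictAntiOn_b.lt_iff_gt h1 h3, h2, h4]

theorem h_z_mem : S.h S.z ∈ Icc (S.h S.z) 1 := ⟨le_rfl, hS.h_z_lt_one.le⟩

theorem one_mem : (1 : ℝ) ∈ Icc (S.h S.z) 1 := ⟨hS.h_z_lt_one.le, le_rfl⟩

theorem u₁_h_z : S.u₁ (S.h S.z) = S.z :=
  hS.strictAntiOn_b.injOn (hS.u₁_spec hS.h_z_mem).1 ⟨hS.ubar_lt_z.le, le_rfl⟩
    ((hS.u₁_spec hS.h_z_mem).2.trans hS.b_z.symm)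

theorem u₁_one : S.u₁ 1 = S.ubar :=
  hS.strictAntiOn_b.injOn (hS.u₁_spec hS.one_mem).1 ⟨le_rfl, hS.ubar_lt_z.le⟩
    ((hS.u₁_spec hS.one_mem).2.trans hS.b_ubar.symm)

theorem u₁_lt_z (hβ : β ∈ Ioc (S.h S.z) 1) : S.u₁ β < S.z := by
  have := hS.u₁_lt_u₁ hS.h_z_mem ⟨hβ.1.le, hβ.2⟩ hβ.1
  rwa [hS.u₁_h_z] at this

theorem ubar_lt_u₁ (hβ : β ∈ Ico (S.h S.z) 1) : S.ubar < S.u₁ β := by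
  have := hS.u₁_lt_u₁ ⟨hβ.1, hβ.2.le⟩ hS.one_mem hβ.2
  rwa [hS.u₁_one] at this

theorem continuousOn_u₁ : ContinuousOn S.u₁ (Icc (S.h S.z) 1) := by
  intro β hβ
  obtain ⟨h1, h2⟩ := hS.u₁_spec hβ
  refine tendsto_order.2 ⟨fun c hc => ?_, fun c hc => ?_⟩
  · rcases lt_or_ge c S.ubar with h | h
    · filter_upwards [self_mem_nhdsWithin] with β' hβ' using h.trans_le (hS.u₁_spec hβ').1.1
    · have hcm : c ∈ Icc S.ubar S.z := ⟨h, hc.le.trans h1.2⟩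
      have h3 : β < S.b c := by
        rw [← h2]
        exact hS.strictAntiOn_b hcm h1 hc
      filter_upwards [self_mem_nhdsWithin, mem_nhdsWithin_of_mem_nhds (Iio_mem_nhds h3)]
        with β' hβ' hlt
      obtain ⟨h4, h5⟩ := hS.u₁_spec hβ'
      rw [← hS.strictAntiOn_b.lt_iff_gt h4 hcm, h5]
      exact hlt
  · rcases lt_or_ge S.z c with h | h
    · filter_upwards [self_mem_nhdsWithin] with β' hβ' using (hS.u₁_spec hβ').1.2.trans_lt h
    · have hcm : c ∈ Icc S.ubar S.z := ⟨h1.1.trans hc.le, h⟩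
      have h3 : S.b c < β := by
        rw [← h2]
        exact hS.strictAntiOn_b h1 hcm hc
      filter_upwards [self_mem_nhdsWithin, mem_nhdsWithin_of_mem_nhds (Ioi_mem_nhds h3)]
        with β' hβ' hlt
      obtain ⟨h4, h5⟩ := hS.u₁_spec hβ'
      rw [← hS.strictAntiOn_b.lt_iff_gt hcm h4, h5]
      exact hlt

theorem continuousOn_m : ContinuousOn S.m (Icc (S.h S.z) 1) := by
  have hmaps : MapsTo S.u₁ (Icc (S.h S.z) 1) (Ici 0) := fun β hβ => (hS.u₁_pos hβ).le
  refine ((hS.c1_dg₂.continuousOn.comp hS.continuousOn_u₁ hmaps).sub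
    (continuousOn_id.mul (hS.c1_dg₁.continuousOn.comp hS.continuousOn_u₁ hmaps))).congr
    fun β hβ => ?_
  exact hS.dgb_eq (hmaps hβ)

theorem continuousOn_dgb_sub_m (hx : 0 ≤ x) :
    ContinuousOn (fun β => S.dgb β x - S.m β) (Icc (S.h S.z) 1) := by
  have : (fun β => S.dgb β x) = fun β => D S.g₂ x - β * D S.g₁ x :=
    funext fun β => hS.dgb_eq hx
  refine ContinuousOn.sub ?_ hS.continuousOn_m
  rw [this]
  fun_prop

/-- For negative `β` the function `g'(·; β)` may be negative near `0`, but it cannot become so again,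
as `g₁' / g₂'` is increasing. -/
theorem dgb_pos_of_le {a : ℝ} (ha : 0 ≤ a) (hax : a ≤ x) (hxl : x ≤ S.xlam)
    (h : 0 < S.dgb β a) : 0 < S.dgb β x := by
  have hx := ha.trans hax
  rcases le_or_gt 0 β with hβ | hβ
  · rw [hS.dgb_eq hx]
    linarith [hS.dg₂_pos hx, mul_nonpos_of_nonneg_of_nonpos hβ (hS.dg₁_nonpos hx hxl)]
  · have heq : ∀ y, 0 ≤ y → S.dgb β y = D S.g₂ y * (1 - β * (D S.g₁ y / D S.g₂ y)) := by
      intro y hy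
      have := (hS.dg₂_pos hy).ne'
      rw [hS.dgb_eq hy]
      field_simp
    rw [heq a ha] at h
    rw [heq x hx]
    have h1 := hS.strictMonoOn_ratio.monotoneOn ha hx hax
    have h2 := pos_of_mul_pos_right h (hS.dg₂_pos ha).le
    exact mul_pos (hS.dg₂_pos hx) (h2.trans_le (by nlinarith))

theorem dgb_pos_of_u₁_le (hβ : β ∈ Icc (S.h S.z) 1) (hx : S.u₁ β ≤ x) : 0 < S.dgb β x := by
  rcases le_total x S.xlam with h | h
  · exact hS.dgb_pos_of_le (hS.u₁_pos hβ).le hx h (hS.m_pos hβ)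
  · exact hS.dgb_pos_of_xlam_le hβ.2 h

/-! ### The inverse branches of `h` -/

theorem hMinus_spec (hβ : β ∈ Icc (S.h S.z) 1) :
    S.hMinus β ∈ Icc S.x1 S.z ∧ S.h (S.hMinus β) = β := by
  obtain ⟨u, hu, hub⟩ := intermediate_value_Icc' hS.x1_lt_z.le
    (hS.continuousOn_h.mono Icc_subset_Ici_self) (show β ∈ _ by rwa [hS.h_x1])
  have hu' : u ∈ Icc S.x1 S.xlam := ⟨hu.1, hu.2.trans hS.z_lt_xlam.le⟩
  have : {x | x ∈ Icc S.x1 S.xlam ∧ S.h x = β} = {u} := by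
    ext y
    simp only [mem_ofPred_eq, mem_singleton_iff]
    refine ⟨fun hy => hS.strictAntiOn_h.injOn hy.1 hu' (hy.2.trans hub.symm), ?_⟩
    rintro rfl
    exact ⟨hu', hub⟩
  rw [hMinus, this, csInf_singleton]
  exact ⟨hu, hub⟩

theorem hMinus_lt_z (hβ : β ∈ Ioc (S.h S.z) 1) : S.hMinus β < S.z := by
  obtain ⟨h1, h2⟩ := hS.hMinus_spec ⟨hβ.1.le, hβ.2⟩
  refine h1.2.lt_of_ne fun h => ?_
  rw [h] at h2
  exact hβ.1.ne h2

theorem h_xlam_lt : S.h S.xlam < S.h S.z :=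
  hS.strictAntiOn_h ⟨hS.x1_lt_z.le, hS.z_lt_xlam.le⟩ ⟨hS.x1_le, le_rfl⟩ hS.z_lt_xlam

theorem hPlus_spec (hβ : S.h S.z ≤ β) (hInf : (β : EReal) < S.hInf) :
    S.xlam < S.hPlus β ∧ S.h (S.hPlus β) = β ∧ ∀ x, S.xlam ≤ x → x < S.hPlus β → S.h x < β := by
  obtain ⟨X, hX, hXβ⟩ := exists_lt_h_of_lt_hInf hInf S.xlam
  have hc : ContinuousOn S.h (Ici S.xlam) := hS.continuousOn_h.mono (Ici_subset_Ici.2 hS.x1_le)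
  have hlt := hS.h_xlam_lt.trans_le hβ
  obtain ⟨w, hw, hwβ⟩ := intermediate_value_Icc hX (hc.mono Icc_subset_Ici_self)
    (show β ∈ _ from ⟨hlt.le, hXβ.le⟩)
  have hclosed : IsClosed {x | x ∈ Ici S.xlam ∧ S.h x = β} :=
    hc.preimage_isClosed_of_isClosed isClosed_Ici (isClosed_singleton (x := β))
  have hbdd : BddBelow {x | x ∈ Ici S.xlam ∧ S.h x = β} := ⟨S.xlam, fun y hy => hy.1⟩
  have hmem := hclosed.csInf_mem ⟨w, hw.1, hwβ⟩ hbdd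
  change S.hPlus β ∈ _ at hmem
  have hmem1 : S.xlam ≤ S.hPlus β := hmem.1
  refine ⟨hmem1.lt_of_ne fun h => ?_, hmem.2, fun x hx hxp => ?_⟩
  · have h1 := hmem.2
    rw [← h] at h1
    exact hlt.ne h1
  · refine lt_of_le_of_ne ?_ fun h => not_lt.2 (csInf_le hbdd ⟨hx, h⟩) hxp
    exact hmem.2 ▸ hS.monotoneOn_h hx hmem1 hxp.le

/-! ### Shape of `g'(·; β)` -/

theorem u₁_lt_hMinus (hβ : β ∈ Ioc (S.h S.z) 1) : S.u₁ β < S.hMinus β := by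
  have hβ' : β ∈ Icc (S.h S.z) 1 := ⟨hβ.1.le, hβ.2⟩
  obtain ⟨h1, h2⟩ := hS.hMinus_spec hβ'
  rcases lt_or_ge (S.u₁ β) S.x1 with h | h
  · exact h.trans_le h1.1
  have h0 := hS.u₁_pos hβ'
  -- as `q < 0` at `u₁(β)`, the identity for `Γ` makes `g''` positive there
  have h3 := hS.lam_mul_Γ (β := β) h0.le
  rw [hS.Γ_u₁ hβ', mul_zero] at h3
  have h4 := mul_neg_of_neg_of_pos (hS.q_neg h0.le (hS.u₁_lt_z hβ)) (hS.m_pos hβ')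
  have h5 : 0 < S.σ (S.u₁ β) ^ 2 / 2 * (S.k * S.ddgb β (S.u₁ β)) := by
    unfold m at h4
    linarith
  have h6 := pos_of_mul_pos_right h5 (half_pos (hS.coefficients.vol_pos _ h0.le)).le
  have h7 := pos_of_mul_pos_right h6 hS.k_pos.le
  rw [hS.ddgb_eq_mul h] at h7
  have h8 := pos_of_mul_pos_right h7 (hS.ddg₁_pos h).le
  have hzl := hS.z_lt_xlam.le
  rw [← hS.strictAntiOn_h.lt_iff_gt ⟨h1.1, h1.2.trans hzl⟩
    ⟨h, (hS.u₁_spec hβ').1.2.trans hzl⟩, h2]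
  linarith

theorem hMinus_lt_xlam (hβ : β ∈ Icc (S.h S.z) 1) : S.hMinus β < S.xlam :=
  (hS.hMinus_spec hβ).1.2.trans_lt hS.z_lt_xlam

theorem hMinus_pos (hβ : β ∈ Icc (S.h S.z) 1) : 0 < S.hMinus β :=
  hS.x1_pos.trans_le (hS.hMinus_spec hβ).1.1

theorem strictAntiOn_dgb_of_h_lt (hβ : β ∈ Icc (S.h S.z) 1) {c : ℝ}
    (hc : ∀ x, S.hMinus β < x → x < c → S.h x < β) :
    StrictAntiOn (S.dgb β) (Icc (S.hMinus β) c) := by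
  have h0 := hS.hMinus_pos hβ
  refine strictAntiOn_of_hasDerivAt (convex_Icc _ _)
    (hS.continuousOn_dgb.mono fun y hy => h0.le.trans hy.1)
    (fun y hy => hS.hasDerivAt_dgb (by rw [interior_Icc] at hy; exact h0.trans hy.1))
    fun y hy => ?_
  rw [interior_Icc] at hy
  have h1 := (hS.hMinus_spec hβ).1.1.trans hy.1.le
  rw [hS.ddgb_eq_mul h1]
  exact mul_neg_of_pos_of_neg (hS.ddg₁_pos h1) (sub_neg.2 (hc y hy.1 hy.2))

theorem h_lt_of_hMinus_lt (hβ : β ∈ Icc (S.h S.z) 1) (hx : S.hMinus β < x) (hxl : x ≤ S.xlam) :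
    S.h x < β := by
  obtain ⟨h1, h2⟩ := hS.hMinus_spec hβ
  have := hS.strictAntiOn_h ⟨h1.1, (hS.hMinus_lt_xlam hβ).le⟩ ⟨h1.1.trans hx.le, hxl⟩ hx
  rwa [h2] at this

theorem strictAntiOn_dgb_xlam (hβ : β ∈ Icc (S.h S.z) 1) :
    StrictAntiOn (S.dgb β) (Icc (S.hMinus β) S.xlam) :=
  hS.strictAntiOn_dgb_of_h_lt hβ fun _ hx hxl => hS.h_lt_of_hMinus_lt hβ hx hxl.le

theorem strictAntiOn_dgb (hβ : β ∈ Icc (S.h S.z) 1) (hInf : (β : EReal) < S.hInf) :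
    StrictAntiOn (S.dgb β) (Icc (S.hMinus β) (S.hPlus β)) :=
  hS.strictAntiOn_dgb_of_h_lt hβ fun x hx hxp => by
    rcases le_total x S.xlam with h | h
    · exact hS.h_lt_of_hMinus_lt hβ hx h
    · exact (hS.hPlus_spec hβ.1 hInf).2.2 x h hxp

theorem monotoneOn_dgb (hβ : S.h S.z ≤ β) (hInf : (β : EReal) < S.hInf) :
    MonotoneOn (S.dgb β) (Ici (S.hPlus β)) := by
  obtain ⟨h1, h2, -⟩ := hS.hPlus_spec hβ hInf
  have h0 := hS.xlam_pos.trans h1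
  refine monotoneOn_of_hasDerivAt (convex_Ici _)
    (hS.continuousOn_dgb.mono (Ici_subset_Ici.2 h0.le))
    (fun y hy => hS.hasDerivAt_dgb (h0.trans_le (interior_subset hy))) fun y hy => ?_
  have hy' : S.hPlus β ≤ y := interior_subset hy
  have h3 := hS.x1_le.trans (h1.le.trans hy')
  rw [hS.ddgb_eq_mul h3]
  have h4 := hS.monotoneOn_h h1.le (h1.le.trans hy') hy'
  rw [h2] at h4
  exact mul_nonneg (hS.ddg₁_pos h3).le (sub_nonneg.2 h4)

/-- Once `g'(·; β)` has left its minimal value on `[h_+^{-1}(β), ∞)`, it increases strictly. -/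
theorem dgb_lt_dgb (hβ : S.h S.z ≤ β) (hInf : (β : EReal) < S.hInf)
    (hx : S.dgb β (S.hPlus β) < S.dgb β x) (hpx : S.hPlus β ≤ x) (hxy : x < y) :
    S.dgb β x < S.dgb β y := by
  obtain ⟨h1, h2, -⟩ := hS.hPlus_spec hβ hInf
  have h0 := hS.xlam_pos.trans h1
  have hhx : β < S.h x := by
    by_contra! hle
    -- otherwise `h = β` on `[h_+^{-1}(β), x]`, and `g'` is constant there
    have hanti : AntitoneOn (S.dgb β) (Icc (S.hPlus β) x) :=
      antitoneOn_of_hasDerivAt (convex_Icc _ _)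
        (hS.continuousOn_dgb.mono fun w hw => h0.le.trans hw.1)
        (fun w hw => hS.hasDerivAt_dgb (h0.trans_le (interior_subset hw).1)) fun w hw => by
          have hw' := interior_subset hw
          have h3 := hS.x1_le.trans (h1.le.trans hw'.1)
          rw [hS.ddgb_eq_mul h3]
          have h4 := hS.monotoneOn_h (h1.le.trans hw'.1) (h1.le.trans hpx) hw'.2
          exact mul_nonpos_of_nonneg_of_nonpos (hS.ddg₁_pos h3).le (by linarith)
    exact not_lt.2 (hanti (left_mem_Icc.2 hpx) (right_mem_Icc.2 hpx) hpx) hx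
  have hx0 := h0.trans_le hpx
  refine strictMonoOn_of_hasDerivAt (convex_Icc x y)
    (hS.continuousOn_dgb.mono fun w hw => hx0.le.trans hw.1)
    (fun w hw => hS.hasDerivAt_dgb (hx0.trans_le (interior_subset hw).1)) (fun w hw => ?_)
    (left_mem_Icc.2 hxy.le) (right_mem_Icc.2 hxy.le) hxy
  have hw' := interior_subset hw
  have h3 := h1.le.trans (hpx.trans hw'.1)
  rw [hS.ddgb_eq_mul (hS.x1_le.trans h3)]
  have h4 := hS.monotoneOn_h (h1.le.trans hpx) h3 hw'.1
  exact mul_pos (hS.ddg₁_pos (hS.x1_le.trans h3)) (by linarith)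

/-! ### Comparison of two parameters -/

theorem Γ_neg (hβ : β ∈ Icc (S.h S.z) 1) (hx : S.u₁ β < x) (hxz : x ≤ S.z) : S.Γ β x < 0 := by
  obtain ⟨h1, h2⟩ := hS.u₁_spec hβ
  have hux := h1.1.trans hx.le
  have hxl := hxz.trans hS.z_lt_xlam.le
  have h3 := hS.strictAntiOn_b h1 ⟨hux, hxz⟩ hx
  have h4 := hS.b_denom_pos hux hxl
  rw [h2, b, div_lt_iff₀ h4] at h3
  rw [Γ, hS.dgb_eq (hS.ubar_pos.le.trans hux), gb]
  linarith

/-- On `[u₁(β), z]` the multiple `k g(·; β) / g'(u₁(β); β)`, which touches the line `k x - K` at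
`u₁(β)`, stays above that line, since `g(x; β) / (k x - K)` increases as long as `Γ ≤ 0`. -/
theorem payment_mul_m_le (hβ : β ∈ Icc (S.h S.z) 1) (hx : S.u₁ β ≤ x) (hxz : x ≤ S.z) :
    (S.k * x - S.K) * S.m β ≤ S.k * S.gb β x := by
  have hu := (hS.u₁_spec hβ).1.1
  have h0 := hS.u₁_pos hβ
  have hp : ∀ {w}, S.u₁ β ≤ w → 0 < S.k * w - S.K := fun hw => hS.payment_pos (hu.trans hw)
  have hpd : ∀ y, HasDerivAt (fun x => S.k * x - S.K) S.k y := fun y => by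
    simpa using ((hasDerivAt_id y).const_mul S.k).sub_const S.K
  have hmono : MonotoneOn (fun x => S.gb β x / (S.k * x - S.K)) (Icc (S.u₁ β) S.z) := by
    refine monotoneOn_of_hasDerivAt (convex_Icc _ _)
      ((hS.continuousOn_gb.mono fun w hw => h0.le.trans hw.1).div (by fun_prop)
        fun w hw => (hp hw.1).ne')
      (f' := fun x => -S.Γ β x / (S.k * x - S.K) ^ 2) (fun w hw => ?_) fun w hw => ?_
    · rw [interior_Icc] at hw
      refine ((hS.hasDerivAt_gb (h0.trans hw.1)).div (hpd w) (hp hw.1.le).ne').congr_deriv ?_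
      unfold Γ
      ring
    · rw [interior_Icc] at hw
      exact div_nonneg (by linarith [hS.Γ_neg hβ hw.1 hw.2.le]) (sq_nonneg _)
  have h1 := hmono ⟨le_rfl, hx.trans hxz⟩ ⟨hx, hxz⟩ hx
  simp only at h1
  rw [div_le_div_iff₀ (hp le_rfl) (hp hx)] at h1
  have h2 := hS.k_mul_gb_u₁ hβ
  have h3 := mul_le_mul_of_nonneg_left h1 hS.k_pos.le
  have h4 : S.k * (S.gb β (S.u₁ β) * (S.k * x - S.K)) =
      (S.k * S.u₁ β - S.K) * S.m β * (S.k * x - S.K) := by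
    linear_combination (S.k * x - S.K) * h2
  refine le_of_mul_le_mul_left ?_ (hp le_rfl)
  linarith

theorem m_lt_dgb_of_le_z (hβ : β ∈ Icc (S.h S.z) 1) (hx : S.u₁ β < x) (hxz : x ≤ S.z) :
    S.m β < S.dgb β x := by
  have h1 := hS.Γ_neg hβ hx hxz
  have h2 := hS.payment_mul_m_le hβ hx.le hxz
  unfold Γ at h1
  exact lt_of_mul_lt_mul_left (by linarith : (S.k * x - S.K) * S.m β < _)
    (hS.payment_pos ((hS.u₁_spec hβ).1.1.trans hx.le)).le

theorem dgb_mul_gb_sub (hx : 0 ≤ x) :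
    S.dgb β' x * S.gb β x - S.gb β' x * S.dgb β x = (β' - β) * S.W x := by
  rw [hS.dgb_eq hx, hS.dgb_eq hx]
  unfold gb W
  ring

theorem strictMonoOn_gb_div_gb (hβ' : β' ≤ 1) (h : β < β') :
    StrictMonoOn (fun x => S.gb β' x / S.gb β x) (Ioi 0) := by
  have hg : ∀ {x}, 0 < x → 0 < S.gb β x := fun hx => hS.gb_pos_of_le_one (h.le.trans hβ') hx
  refine strictMonoOn_of_hasDerivAt (convex_Ioi 0)
    ((hS.continuousOn_gb.mono Ioi_subset_Ici_self).div
      (hS.continuousOn_gb.mono Ioi_subset_Ici_self) fun x hx => (hg hx).ne')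
    (f' := fun x => (β' - β) * S.W x / S.gb β x ^ 2) (fun x hx => ?_) fun x hx => ?_
  · rw [interior_Ioi] at hx
    refine ((hS.hasDerivAt_gb hx).div (hS.hasDerivAt_gb hx) (hg hx).ne').congr_deriv ?_
    rw [← hS.dgb_mul_gb_sub (le_of_lt hx)]
  · rw [interior_Ioi] at hx
    have h1 := hg hx
    have h2 := mul_pos (sub_pos.2 h) (hS.W_pos (le_of_lt hx))
    positivity

theorem gb_ratio_u₁ (hβ : β ∈ Icc (S.h S.z) 1) (hβ' : β' ∈ Icc (S.h S.z) 1) (h : β < β') :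
    S.m β' / S.m β ≤ S.gb β' (S.u₁ β) / S.gb β (S.u₁ β) := by
  have hu := (hS.u₁_spec hβ).1
  have h1 := hS.payment_mul_m_le hβ' (hS.u₁_lt_u₁ hβ hβ' h).le hu.2
  have h2 := hS.k_mul_gb_u₁ hβ
  have h3 := hS.payment_pos hu.1
  rw [div_le_div_iff₀ (hS.m_pos hβ) (hS.gb_pos_of_le_one hβ.2 (hS.u₁_pos hβ))]
  refine le_of_mul_le_mul_left ?_ hS.k_pos
  calc S.k * (S.m β' * S.gb β (S.u₁ β)) = (S.k * S.u₁ β - S.K) * S.m β' * S.m β := by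
        linear_combination S.m β' * h2
    _ ≤ S.k * S.gb β' (S.u₁ β) * S.m β := mul_le_mul_of_nonneg_right h1 (hS.m_pos hβ).le
    _ = _ := by ring

theorem gb_div_m_le (hβ : β ∈ Icc (S.h S.z) 1) (hβ' : β' ∈ Icc (S.h S.z) 1) (h : β < β')
    (hx : S.u₁ β ≤ x) : S.gb β x / S.m β ≤ S.gb β' x / S.m β' := by
  have h0 := hS.u₁_pos hβ
  have h1 := (hS.gb_ratio_u₁ hβ hβ' h).trans
    ((hS.strictMonoOn_gb_div_gb hβ'.2 h).monotoneOn h0 (h0.trans_le hx) hx)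
  rw [div_le_div_iff₀ (hS.m_pos hβ) (hS.gb_pos_of_le_one hβ.2 (h0.trans_le hx))] at h1
  rw [div_le_div_iff₀ (hS.m_pos hβ) (hS.m_pos hβ')]
  linarith

/-- The normalized slope `g'(x; β) / g'(u₁(β); β)` increases with `β`, with a factor that is
uniform for `x` bounded away from `u₁(β)`. -/
theorem exists_factor (hβ : β ∈ Icc (S.h S.z) 1) (hβ' : β' ∈ Icc (S.h S.z) 1) (h : β < β')
    {a : ℝ} (ha : S.u₁ β < a) :
    ∃ ρ > 1, ∀ x, a ≤ x → ρ * (S.dgb β x / S.m β) ≤ S.dgb β' x / S.m β' := by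
  have h0 := hS.u₁_pos hβ
  have ha0 := h0.trans ha
  have hm := hS.m_pos hβ
  have hm' := hS.m_pos hβ'
  have hmono := hS.strictMonoOn_gb_div_gb hβ'.2 h
  have h1 : S.m β' / S.m β < S.gb β' a / S.gb β a :=
    (hS.gb_ratio_u₁ hβ hβ' h).trans_lt (hmono h0 ha0 ha)
  refine ⟨S.gb β' a / S.gb β a * (S.m β / S.m β'), ?_, fun x hx => ?_⟩
  · have h2 := mul_lt_mul_of_pos_right h1 (div_pos hm hm')
    rwa [div_mul_div_cancel₀ hm.ne', div_self hm'.ne'] at h2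
  · have hx0 := ha0.trans_le hx
    have hg := hS.gb_pos_of_le_one hβ.2 hx0
    have hd := hS.dgb_pos_of_u₁_le hβ (ha.le.trans hx)
    have h3 : S.gb β' a / S.gb β a * S.dgb β x ≤ S.dgb β' x := by
      have h4 := hmono.monotoneOn ha0 hx0 hx
      refine (mul_le_mul_of_nonneg_right h4 hd.le).trans ?_
      rw [div_mul_eq_mul_div, div_le_iff₀ hg]
      have := hS.dgb_mul_gb_sub (β := β) (β' := β') hx0.le
      linarith [mul_pos (sub_pos.2 h) (hS.W_pos hx0.le)]
    calc _ = S.gb β' a / S.gb β a * S.dgb β x / S.m β' := by field_simp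
      _ ≤ _ := div_le_div_of_nonneg_right h3 hm'.le

end Problem

/-! ### The points `u₂` and `u₃` -/

/-- The parameters for which `g'(·; β)` attains the value `g'(u₁(β); β)` on both sides of its
minimum at `h_+^{-1}(β)`. -/
structure Admissible (S : Data) (β : ℝ) : Prop where
  mem : β ∈ Ioo (S.h S.z) 1
  lt_hInf : (β : EReal) < S.hInf
  below : S.dgb β (S.hPlus β) < S.m β
  above : ∃ y, S.hPlus β < y ∧ S.m β < S.dgb β y

namespace Admissible

variable (hS : S.Problem) (hβ : S.Admissible β)
include hβ

theorem mem_Icc : β ∈ Icc (S.h S.z) 1 := ⟨hβ.mem.1.le, hβ.mem.2.le⟩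

theorem mem_Ioc : β ∈ Ioc (S.h S.z) 1 := ⟨hβ.mem.1, hβ.mem.2.le⟩

include hS

theorem xlam_lt_hPlus : S.xlam < S.hPlus β := (hS.hPlus_spec hβ.mem.1.le hβ.lt_hInf).1

theorem u₂_spec : S.u₂ β ∈ Ioo (S.hMinus β) (S.hPlus β) ∧ S.dgb β (S.u₂ β) = S.m β := by
  have hanti := hS.strictAntiOn_dgb hβ.mem_Icc hβ.lt_hInf
  have h1 : S.hMinus β < S.hPlus β :=
    (hS.hMinus_lt_xlam hβ.mem_Icc).trans (hβ.xlam_lt_hPlus hS)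
  have h2 : S.m β < S.dgb β (S.hMinus β) :=
    hS.m_lt_dgb_of_le_z hβ.mem_Icc (hS.u₁_lt_hMinus hβ.mem_Ioc) (hS.hMinus_lt_z hβ.mem_Ioc).le
  obtain ⟨u, hu, hum⟩ := intermediate_value_Ioo' h1.le
    (hS.continuousOn_dgb.mono fun y hy => (hS.hMinus_pos hβ.mem_Icc).le.trans hy.1)
    (show S.m β ∈ _ from ⟨hβ.below, h2⟩)
  have : {u | u ∈ Ioo (S.hMinus β) (S.hPlus β) ∧ S.dgb β u = S.dgb β (S.u₁ β)} = {u} := by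
    ext y
    simp only [mem_ofPred_eq, mem_singleton_iff]
    refine ⟨fun hy => hanti.injOn (Ioo_subset_Icc_self hy.1) (Ioo_subset_Icc_self hu)
      (hy.2.trans hum.symm), ?_⟩
    rintro rfl
    exact ⟨hu, hum⟩
  rw [u₂, this, csInf_singleton]
  exact ⟨hu, hum⟩

theorem u₃_spec : S.hPlus β < S.u₃ β ∧ S.dgb β (S.u₃ β) = S.m β := by
  obtain ⟨X, hX, hXm⟩ := hβ.above
  have h0 := hS.xlam_pos.trans (hβ.xlam_lt_hPlus hS)
  obtain ⟨u, hu, hum⟩ := intermediate_value_Ioo hX.le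
    (hS.continuousOn_dgb.mono fun y hy => h0.le.trans hy.1)
    (show S.m β ∈ _ from ⟨hβ.below, hXm⟩)
  have huniq : ∀ {y w}, S.hPlus β < y → S.dgb β y = S.m β → y < w → S.m β < S.dgb β w := by
    intro y w hy hym hyw
    rw [← hym]
    exact hS.dgb_lt_dgb hβ.mem.1.le hβ.lt_hInf (hym ▸ hβ.below) hy.le hyw
  have : {u | u ∈ Ioi (S.hPlus β) ∧ S.dgb β u = S.dgb β (S.u₁ β)} = {u} := by
    ext y
    simp only [mem_ofPred_eq, mem_singleton_iff]
    constructor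
    · rintro ⟨hy, hym⟩
      rcases lt_trichotomy y u with h | h | h
      · exact absurd hum (huniq hy hym h).ne'
      · exact h
      · exact absurd hym (huniq hu.1 hum h).ne'
    · rintro rfl
      exact ⟨hu.1, hum⟩
  rw [u₃, this, csInf_singleton]
  exact ⟨hu.1, hum⟩

theorem z_lt_u₂ : S.z < S.u₂ β := by
  obtain ⟨h1, h2⟩ := hβ.u₂_spec hS
  by_contra! h
  have h3 := hS.m_lt_dgb_of_le_z hβ.mem_Icc ((hS.u₁_lt_hMinus hβ.mem_Ioc).trans h1.1) h
  exact h3.ne' h2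

theorem u₂_lt_u₃ : S.u₂ β < S.u₃ β := (hβ.u₂_spec hS).1.2.trans (hβ.u₃_spec hS).1

theorem m_lt_dgb_of_lt_u₂ (hx : S.u₁ β < x) (hx2 : x < S.u₂ β) : S.m β < S.dgb β x := by
  rcases le_total x S.z with h | h
  · exact hS.m_lt_dgb_of_le_z hβ.mem_Icc hx h
  · obtain ⟨h1, h2⟩ := hβ.u₂_spec hS
    rw [← h2]
    exact hS.strictAntiOn_dgb hβ.mem_Icc hβ.lt_hInf
      ⟨(hS.hMinus_lt_z hβ.mem_Ioc).le.trans h, (hx2.trans h1.2).le⟩ ⟨h1.1.le, h1.2.le⟩ hx2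

theorem m_lt_dgb_of_u₃_lt (hx : S.u₃ β < x) : S.m β < S.dgb β x := by
  obtain ⟨h1, h2⟩ := hβ.u₃_spec hS
  rw [← h2]
  exact hS.dgb_lt_dgb hβ.mem.1.le hβ.lt_hInf (h2 ▸ hβ.below) h1.le hx

theorem dgb_lt_m (hx2 : S.u₂ β < x) (hx3 : x < S.u₃ β) : S.dgb β x < S.m β := by
  obtain ⟨h1, h2⟩ := hβ.u₂_spec hS
  obtain ⟨h3, h4⟩ := hβ.u₃_spec hS
  rcases le_total x (S.hPlus β) with h | h
  · rw [← h2]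
    exact hS.strictAntiOn_dgb hβ.mem_Icc hβ.lt_hInf ⟨h1.1.le, h1.2.le⟩
      ⟨(h1.1.trans hx2).le, h⟩ hx2
  · by_contra! hle
    have h5 := hS.dgb_lt_dgb hβ.mem.1.le hβ.lt_hInf (hβ.below.trans_le hle) h hx3
    linarith

end Admissible

/-! ### The range of admissible parameters -/

/-- The set whose supremum is `β₀`. -/
def β₀Set (S : Data) : Set ℝ :=
  {β₁ | β₁ ∈ Ioc (S.h S.z) 1 ∧ ∀ β ∈ Ioc (S.h S.z) β₁, S.v β ≤ 1}

theorem β₀Set_bddAbove (S : Data) : BddAbove S.β₀Set := ⟨1, fun _ h => h.1.2⟩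

namespace Problem

variable (hS : S.Problem)
include hS

theorem one_lt_G_iff (hβ : β ∈ Icc (S.h S.z) 1) :
    1 < S.G β ↔ (S.m β : EReal) < limInfty (S.dgb β) := by
  have hm := hS.m_pos hβ
  have := EReal.lt_div_iff (a := 1) (b := (S.m β : EReal)) (c := limInfty (S.dgb β))
    (EReal.coe_pos.2 hm) (EReal.coe_ne_top _)
  rwa [one_mul] at this

theorem one_le_G_iff (hβ : β ∈ Icc (S.h S.z) 1) :
    1 ≤ S.G β ↔ (S.m β : EReal) ≤ limInfty (S.dgb β) := by
  have hm := hS.m_pos hβ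
  have := EReal.le_div_iff_mul_le (a := 1) (b := (S.m β : EReal)) (c := limInfty (S.dgb β))
    (EReal.coe_pos.2 hm) (EReal.coe_ne_top _)
  rwa [one_mul] at this

theorem dgb_hPlus_le (hβ : β ∈ Icc (S.h S.z) 1) (hInf : (β : EReal) < S.hInf)
    (hx : S.hMinus β ≤ x) : S.dgb β (S.hPlus β) ≤ S.dgb β x := by
  rcases le_total x (S.hPlus β) with h | h
  · exact (hS.strictAntiOn_dgb hβ hInf).antitoneOn ⟨hx, h⟩ ⟨hx.trans h, le_rfl⟩ h
  · exact hS.monotoneOn_dgb hβ.1 hInf (mem_Ici.2 le_rfl) h h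

theorem v_le_one_iff (hβ : β ∈ Icc (S.h S.z) 1) :
    S.v β ≤ 1 ↔ (β : EReal) < S.hInf ∧ S.dgb β (S.hPlus β) ≤ S.m β := by
  unfold v
  split_ifs with h
  · change ((S.dgb β (S.hPlus β) / S.m β : ℝ) : EReal) ≤ 1 ↔ _
    rw [← EReal.coe_one, EReal.coe_le_coe_iff, div_le_one (hS.m_pos hβ)]
    exact ⟨fun h' => ⟨h.2, h'⟩, fun h' => h'.2⟩
  · simp only [top_le_iff]
    exact ⟨fun h' => absurd h' (EReal.coe_ne_top 1), fun h' => absurd ⟨hβ, h'.1⟩ h⟩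

theorem v_le_one_of_dgb_le (hβ : β ∈ Icc (S.h S.z) 1) (hInf : (β : EReal) < S.hInf)
    (hx : S.hMinus β ≤ x) (h : S.dgb β x ≤ S.m β) : S.v β ≤ 1 :=
  (hS.v_le_one_iff hβ).2 ⟨hInf, (hS.dgb_hPlus_le hβ hInf hx).trans h⟩

/-- A value of `g'(·; β)` below `g'(u₁(β); β)` persists for slightly larger parameters. -/
theorem exists_v_le_one (hβ : β ∈ Ico (S.h S.z) 1) (hInf : (β : EReal) < S.hInf)
    (hx : S.xlam ≤ x) (h : S.dgb β x < S.m β) :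
    ∃ β₁ ∈ Ioc β 1, ∀ β' ∈ Ioc β β₁, S.v β' ≤ 1 := by
  have hx0 := hS.xlam_pos.le.trans hx
  have hβ' : β ∈ Icc (S.h S.z) 1 := ⟨hβ.1, hβ.2.le⟩
  have hle : 𝓝[>] β ≤ 𝓝[Icc (S.h S.z) 1] β := by
    rw [← nhdsWithin_Ioo_eq_nhdsGT hβ.2]
    exact nhdsWithin_mono _ fun w hw => ⟨hβ.1.trans hw.1.le, hw.2.le⟩
  have h1 : ∀ᶠ β' in 𝓝[>] β, S.dgb β' x - S.m β' < 0 :=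
    hle ((hS.continuousOn_dgb_sub_m hx0 β hβ').tendsto.eventually_lt_const (sub_neg.2 h))
  have h2 : ∀ᶠ β' : ℝ in 𝓝[>] β, (β' : EReal) < S.hInf :=
    nhdsWithin_le_nhds (continuous_coe_real_ereal.continuousAt.eventually (eventually_lt_nhds hInf))
  obtain ⟨c, hc, hsub⟩ := (mem_nhdsGT_iff_exists_mem_Ioc_Ioo_subset hβ.2).1 (h1.and h2)
  obtain ⟨β₁, hβ₁⟩ := exists_between hc.1
  refine ⟨β₁, ⟨hβ₁.1, (hβ₁.2.trans_le hc.2).le⟩, fun β' hβ'' => ?_⟩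
  obtain ⟨h3, h4⟩ := hsub ⟨hβ''.1, hβ''.2.trans_lt hβ₁.2⟩
  have hmem : β' ∈ Icc (S.h S.z) 1 :=
    ⟨hβ.1.trans hβ''.1.le, hβ''.2.trans (hβ₁.2.trans_le hc.2).le⟩
  exact hS.v_le_one_of_dgb_le hmem h4 ((hS.hMinus_lt_xlam hmem).le.trans hx)
    (sub_neg.1 h3).le

theorem β₀Set_nonempty (hInf : (S.h S.z : EReal) < S.hInf) : S.β₀Set.Nonempty := by
  have h0 := hS.h_z_mem
  obtain ⟨h1, -, -⟩ := hS.hPlus_spec le_rfl hInf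
  have h2 : S.dgb (S.h S.z) (S.hPlus (S.h S.z)) < S.m (S.h S.z) := by
    rw [m, hS.u₁_h_z]
    have hz := (hS.hMinus_spec h0).1.2
    have hzp := hS.z_lt_xlam.trans h1
    exact hS.strictAntiOn_dgb h0 hInf ⟨hz, hzp.le⟩ ⟨hz.trans hzp.le, le_rfl⟩ hzp
  exact hS.exists_v_le_one ⟨le_rfl, hS.h_z_lt_one⟩ hInf h1.le h2

theorem h_z_lt_β₀ (hInf : (S.h S.z : EReal) < S.hInf) : S.h S.z < S.β₀ := by
  obtain ⟨w, hw⟩ := hS.β₀Set_nonempty hInf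
  exact hw.1.1.trans_le (le_csSup S.β₀Set_bddAbove hw)

theorem β₀_le_one (hInf : (S.h S.z : EReal) < S.hInf) : S.β₀ ≤ 1 :=
  csSup_le (hS.β₀Set_nonempty hInf) fun _ h => h.1.2

theorem β₀_mem_Icc (hInf : (S.h S.z : EReal) < S.hInf) : S.β₀ ∈ Icc (S.h S.z) 1 :=
  ⟨(hS.h_z_lt_β₀ hInf).le, hS.β₀_le_one hInf⟩

theorem v_le_one_of_lt_β₀ (hInf : (S.h S.z : EReal) < S.hInf) (hβ : β ∈ Ioo (S.h S.z) S.β₀) :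
    S.v β ≤ 1 := by
  obtain ⟨w, hw, hlt⟩ := exists_lt_of_lt_csSup (hS.β₀Set_nonempty hInf) hβ.2
  exact hw.2 β ⟨hβ.1, hlt.le⟩

theorem mem_Icc_of_lt_β₀ (hInf : (S.h S.z : EReal) < S.hInf) (hβ : β ∈ Ioo (S.h S.z) S.β₀) :
    β ∈ Icc (S.h S.z) 1 :=
  ⟨hβ.1.le, hβ.2.le.trans (hS.β₀_le_one hInf)⟩

theorem lt_hInf_of_lt_β₀ (hInf : (S.h S.z : EReal) < S.hInf) (hβ : β ∈ Ioo (S.h S.z) S.β₀) :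
    (β : EReal) < S.hInf :=
  ((hS.v_le_one_iff (hS.mem_Icc_of_lt_β₀ hInf hβ)).1 (hS.v_le_one_of_lt_β₀ hInf hβ)).1

/-- The inequality `v(β) ≤ 1` is strict below `β₀` since the normalized slope increases strictly
with `β`. -/
theorem dgb_hPlus_lt_m (hInf : (S.h S.z : EReal) < S.hInf) (hβ : β ∈ Ioo (S.h S.z) S.β₀) :
    S.dgb β (S.hPlus β) < S.m β := by
  obtain ⟨β', h1, h2⟩ := exists_between hβ.2
  have hβ' : β' ∈ Ioo (S.h S.z) S.β₀ := ⟨hβ.1.trans h1, h2⟩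
  have hm := hS.mem_Icc_of_lt_β₀ hInf hβ
  have hm' := hS.mem_Icc_of_lt_β₀ hInf hβ'
  obtain ⟨h3, h4⟩ := (hS.v_le_one_iff hm').1 (hS.v_le_one_of_lt_β₀ hInf hβ')
  have h5 := (hS.hPlus_spec hβ'.1.le h3).1
  obtain ⟨ρ, hρ, hcomp⟩ := hS.exists_factor hm hm' h1
    ((hS.u₁_spec hm).1.2.trans_lt hS.z_lt_xlam)
  have h6 := (hcomp _ h5.le).trans ((div_le_one (hS.m_pos hm')).2 h4)
  have h7 : 0 < S.dgb β (S.hPlus β') / S.m β :=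
    div_pos (hS.dgb_pos_of_xlam_le hm.2 h5.le) (hS.m_pos hm)
  have h8 : S.dgb β (S.hPlus β') / S.m β < 1 := by nlinarith
  exact (hS.dgb_hPlus_le hm (hS.lt_hInf_of_lt_β₀ hInf hβ)
    ((hS.hMinus_lt_xlam hm).le.trans h5.le)).trans_lt ((div_lt_one (hS.m_pos hm)).1 h8)

/-- At `β₀` the function `g'(·; β)` no longer falls below its value at `u₁`: below `min 1 h_∞`
by maximality of `β₀`, at `1` because `cstar ≥ c^∞`, and at `h_∞` because `G(h_∞) > 1`. -/
theorem m_β₀_le (hInf : (S.h S.z : EReal) < S.hInf)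
    (hh : S.hInf = 1 ∨ (S.hInf < 1 ∧ 1 < S.G S.hInf.toReal)) (hx : S.xlam ≤ x) :
    S.m S.β₀ ≤ S.dgb S.β₀ x := by
  have hmem := hS.β₀_mem_Icc hInf
  by_contra! hlt
  rcases hmem.2.eq_or_lt with h1 | h1
  · rw [h1, m, hS.u₁_one] at hlt
    exact not_lt.2 (hS.dgb_one_ubar_le (hS.x1_le.trans hx)) hlt
  rcases lt_or_ge (S.β₀ : EReal) S.hInf with h2 | h2
  · obtain ⟨w, hw, hv⟩ := hS.exists_v_le_one ⟨hmem.1, h1⟩ h2 hx hlt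
    refine not_le.2 hw.1 (le_csSup S.β₀Set_bddAbove ⟨⟨hmem.1.trans_lt hw.1, hw.2⟩, fun β hβ => ?_⟩)
    rcases lt_trichotomy β S.β₀ with h | h | h
    · exact hS.v_le_one_of_lt_β₀ hInf ⟨hβ.1, h⟩
    · rw [h]
      exact hS.v_le_one_of_dgb_le hmem h2 ((hS.hMinus_lt_xlam hmem).le.trans hx) hlt.le
    · exact hv β ⟨h, hβ.2⟩
  · have h3 : S.hInf = (S.β₀ : EReal) := by
      refine le_antisymm ?_ ?_
      · exact h2
      · refine le_of_tendsto (continuous_coe_real_ereal.continuousAt.tendsto.mono_left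
          nhdsWithin_le_nhds : Tendsto _ (𝓝[<] S.β₀) _) ?_
        filter_upwards [Ioo_mem_nhdsLT (hS.h_z_lt_β₀ hInf)] with β hβ
          using (hS.lt_hInf_of_lt_β₀ hInf hβ).le
    rcases hh with hh | ⟨-, hh⟩
    · rw [hh] at h2
      exact absurd h2 (not_le.2 (by exact_mod_cast h1))
    rw [h3, EReal.toReal_coe, hS.one_lt_G_iff hmem] at hh
    have hanti : AntitoneOn (S.dgb S.β₀) (Ici S.xlam) :=
      antitoneOn_of_hasDerivAt (convex_Ici _)
        (hS.continuousOn_dgb.mono (Ici_subset_Ici.2 hS.xlam_pos.le))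
        (fun y hy => hS.hasDerivAt_dgb (hS.xlam_pos.trans_le (interior_subset hy))) fun y hy => by
          have hy' : S.xlam ≤ y := interior_subset hy
          rw [hS.ddgb_eq_mul (hS.x1_le.trans hy')]
          have h4 := hS.h_le_hInf hy'
          rw [h3, EReal.coe_le_coe_iff] at h4
          exact mul_nonpos_of_nonneg_of_nonpos (hS.ddg₁_pos (hS.x1_le.trans hy')).le (by linarith)
    have h5 : limInfty (S.dgb S.β₀) ≤ (S.dgb S.β₀ x : EReal) := by
      refine limsup_le_of_le (by isBoundedDefault) ?_
      filter_upwards [eventually_ge_atTop x] with y hy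
      exact EReal.coe_le_coe_iff.2 (hanti hx (hx.trans hy) hy)
    exact not_lt.2 h5 (hh.trans' (EReal.coe_lt_coe_iff.2 hlt))

/-- If `G(β) ≥ 1` then `G > 1` for larger parameters, in the sense that `g'(·; β')` exceeds its
value at `u₁(β')` arbitrarily far out. -/
theorem exists_m_lt_dgb (hβ : β ∈ Icc (S.h S.z) 1) (hβ' : β' ∈ Icc (S.h S.z) 1) (h : β < β')
    (hG : 1 ≤ S.G β) (a : ℝ) : ∃ y, a < y ∧ S.m β' < S.dgb β' y := by
  obtain ⟨ρ, hρ, hcomp⟩ := hS.exists_factor hβ hβ' h ((hS.u₁_spec hβ).1.2.trans_lt hS.z_lt_xlam)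
  have hm := hS.m_pos hβ
  have hlt : ((S.m β / ρ : ℝ) : EReal) < limInfty (S.dgb β) :=
    (EReal.coe_lt_coe_iff.2 (div_lt_self hm hρ)).trans_le ((hS.one_le_G_iff hβ).1 hG)
  obtain ⟨y, hy, hay, hyl⟩ := ((frequently_lt_of_lt_limsup (by isBoundedDefault) hlt).and_eventually
    ((eventually_gt_atTop a).and (eventually_ge_atTop S.xlam))).exists
  refine ⟨y, hay, ?_⟩
  rw [EReal.coe_lt_coe_iff, div_lt_iff₀ (zero_lt_one.trans hρ)] at hy
  rw [← one_lt_div (hS.m_pos hβ')]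
  refine lt_of_lt_of_le ?_ (hcomp y hyl)
  rw [← mul_div_assoc, one_lt_div hm]
  linarith

theorem α₀_mem (hInf : (S.h S.z : EReal) < S.hInf) (hex : S.AlphaZeroExists) :
    S.α₀ ∈ Ico (S.h S.z) S.β₀ := by
  unfold α₀
  split_ifs with h
  · exact ⟨le_rfl, hS.h_z_lt_β₀ hInf⟩
  · obtain ⟨w, hw⟩ := hex.resolve_left h
    have hlb : S.h S.z ∈ lowerBounds {α₁ | S.IsAlphaOne α₁} := fun w hw => hw.1.1.le
    exact ⟨le_csInf ⟨w, hw⟩ hlb, (csInf_le ⟨_, hlb⟩ hw).trans_lt hw.1.2⟩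

theorem exists_one_le_G (hInf : (S.h S.z : EReal) < S.hInf) (hex : S.AlphaZeroExists)
    (hβ : S.α₀ < β) : ∃ α < β, α ∈ Icc (S.h S.z) 1 ∧ 1 ≤ S.G α := by
  unfold α₀ at hβ
  split_ifs at hβ with h
  · exact ⟨_, hβ, hS.h_z_mem, h⟩
  · obtain ⟨w, hw, hlt⟩ := exists_lt_of_csInf_lt (hex.resolve_left h) hβ
    exact ⟨w, hlt, hS.mem_Icc_of_lt_β₀ hInf hw.1, hw.2.ge⟩

theorem admissible (hInf : (S.h S.z : EReal) < S.hInf) (hex : S.AlphaZeroExists)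
    (hβ : β ∈ Ioo S.α₀ S.β₀) : S.Admissible β := by
  have hβ' : β ∈ Ioo (S.h S.z) S.β₀ := ⟨(hS.α₀_mem hInf hex).1.trans_lt hβ.1, hβ.2⟩
  obtain ⟨α, hα, hmem, hG⟩ := hS.exists_one_le_G hInf hex hβ.1
  exact ⟨⟨hβ'.1, hβ.2.trans_le (hS.β₀_le_one hInf)⟩, hS.lt_hInf_of_lt_β₀ hInf hβ',
    hS.dgb_hPlus_lt_m hInf hβ',
    hS.exists_m_lt_dgb hmem (hS.mem_Icc_of_lt_β₀ hInf hβ') hα hG _⟩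

end Problem

/-! ### The functionals `J` -/

/-- The primitive `Ψ(β, ·)` of `k (1 - g'(·; β) / g'(u₁(β); β))` that vanishes at `u₁(β)`. -/
noncomputable def Ψ (S : Data) (β x : ℝ) : ℝ := S.k * x - S.K - S.k * (S.gb β x / S.m β)

theorem J_eq_sub {a b : ℝ} (hb : S.dgb β b = S.m β) : S.J β a b = S.Ψ β b - S.Ψ β a := by
  unfold J Ψ
  rw [hb]
  ring

namespace Problem

variable (hS : S.Problem)
include hS

theorem hasDerivAt_Ψ (hx : 0 < x) :
    HasDerivAt (S.Ψ β) (S.k * (1 - S.dgb β x / S.m β)) x := by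
  have h1 : HasDerivAt (fun x => S.k * x - S.K) S.k x := by
    simpa using ((hasDerivAt_id x).const_mul S.k).sub_const S.K
  exact (h1.sub (((hS.hasDerivAt_gb hx).div_const (S.m β)).const_mul S.k)).congr_deriv (by ring)

theorem continuousOn_Ψ : ContinuousOn (S.Ψ β) (Ici 0) :=
  (by fun_prop : ContinuousOn (fun x => S.k * x - S.K) _).sub
    (continuousOn_const.mul (hS.continuousOn_gb.div_const _))

theorem Ψ_u₁ (hβ : β ∈ Icc (S.h S.z) 1) : S.Ψ β (S.u₁ β) = 0 := by
  have h1 := hS.k_mul_gb_u₁ hβ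
  have h2 := (hS.m_pos hβ).ne'
  unfold Ψ
  rw [← mul_div_assoc, h1, mul_div_cancel_right₀ _ h2, sub_self]

theorem strictAntiOn_Ψ (hβ : β ∈ Icc (S.h S.z) 1) {a b : ℝ} (ha : S.u₁ β ≤ a)
    (h : ∀ x, a < x → x < b → S.m β < S.dgb β x) : StrictAntiOn (S.Ψ β) (Icc a b) := by
  have h0 := (hS.u₁_pos hβ).trans_le ha
  refine strictAntiOn_of_hasDerivAt (convex_Icc a b)
    (hS.continuousOn_Ψ.mono fun x hx => h0.le.trans hx.1)
    (fun x hx => hS.hasDerivAt_Ψ (h0.trans_le (interior_subset hx).1)) fun x hx => ?_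
  rw [interior_Icc] at hx
  exact mul_neg_of_pos_of_neg hS.k_pos
    (sub_neg.2 ((one_lt_div (hS.m_pos hβ)).2 (h x hx.1 hx.2)))

theorem strictMonoOn_Ψ (hβ : β ∈ Icc (S.h S.z) 1) {a b : ℝ} (ha : S.u₁ β ≤ a)
    (h : ∀ x, a < x → x < b → S.dgb β x < S.m β) : StrictMonoOn (S.Ψ β) (Icc a b) := by
  have h0 := (hS.u₁_pos hβ).trans_le ha
  refine strictMonoOn_of_hasDerivAt (convex_Icc a b)
    (hS.continuousOn_Ψ.mono fun x hx => h0.le.trans hx.1)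
    (fun x hx => hS.hasDerivAt_Ψ (h0.trans_le (interior_subset hx).1)) fun x hx => ?_
  rw [interior_Icc] at hx
  exact mul_pos hS.k_pos (sub_pos.2 ((div_lt_one (hS.m_pos hβ)).2 (h x hx.1 hx.2)))

theorem antitoneOn_Ψ (hβ : β ∈ Icc (S.h S.z) 1) {a : ℝ} (ha : S.u₁ β ≤ a)
    (h : ∀ x, a < x → S.m β ≤ S.dgb β x) : AntitoneOn (S.Ψ β) (Ici a) := by
  have h0 := (hS.u₁_pos hβ).trans_le ha
  refine antitoneOn_of_hasDerivAt (convex_Ici a)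
    (hS.continuousOn_Ψ.mono (Ici_subset_Ici.2 h0.le))
    (fun x hx => hS.hasDerivAt_Ψ (h0.trans_le (interior_subset hx))) fun x hx => ?_
  rw [interior_Ici] at hx
  exact mul_nonpos_of_nonneg_of_nonpos hS.k_pos.le
    (sub_nonpos.2 ((one_le_div (hS.m_pos hβ)).2 (h x hx)))

/-- Continuity in the parameter, for a point that may vary continuously with it. -/
theorem continuousOn_Ψ_comp {s : Set ℝ} (hs : s ⊆ Icc (S.h S.z) 1) {u : ℝ → ℝ}
    (hu : ContinuousOn u s) (hpos : ∀ β ∈ s, 0 ≤ u β) :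
    ContinuousOn (fun β => S.Ψ β (u β)) s :=
  ((continuousOn_const.mul hu).sub continuousOn_const).sub (continuousOn_const.mul
    (((hS.c1_g₂.continuousOn.comp hu hpos).sub
      (continuousOn_id.mul (hS.c1_g₁.continuousOn.comp hu hpos))).div
      (hS.continuousOn_m.mono hs) fun _ hβ => (hS.m_pos (hs hβ)).ne'))

end Problem

namespace Admissible

variable (hS : S.Problem) (hβ : S.Admissible β)
include hS hβ

theorem u₁_lt_z : S.u₁ β < S.z := hS.u₁_lt_z hβ.mem_Ioc

theorem u₁_lt_u₂ : S.u₁ β < S.u₂ β := (hβ.u₁_lt_z hS).trans (hβ.z_lt_u₂ hS)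

theorem xlam_lt_u₃ : S.xlam < S.u₃ β := (hβ.xlam_lt_hPlus hS).trans (hβ.u₃_spec hS).1

theorem mem_Ioo_of_dgb_lt (hx : S.u₁ β < x) (h : S.dgb β x < S.m β) :
    x ∈ Ioo (S.u₂ β) (S.u₃ β) := by
  refine ⟨lt_of_not_ge fun hle => ?_, lt_of_not_ge fun hle => ?_⟩
  · rcases hle.eq_or_lt with rfl | h'
    · exact h.ne (hβ.u₂_spec hS).2
    · exact h.not_gt (hβ.m_lt_dgb_of_lt_u₂ hS hx h')
  · rcases hle.eq_or_lt with rfl | h'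
    · exact h.ne (hβ.u₃_spec hS).2
    · exact h.not_gt (hβ.m_lt_dgb_of_u₃_lt hS h')

theorem lt_u₂_or_u₃_lt_of_lt_dgb (h : S.m β < S.dgb β x) :
    x < S.u₂ β ∨ S.u₃ β < x := by
  by_contra! hcon
  rcases hcon.1.eq_or_lt with h1 | h1
  · rw [← h1, (hβ.u₂_spec hS).2] at h
    exact lt_irrefl _ h
  · rcases hcon.2.eq_or_lt with h2 | h2
    · rw [h2, (hβ.u₃_spec hS).2] at h
      exact lt_irrefl _ h
    · exact h.not_gt (hβ.dgb_lt_m hS h1 h2)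

theorem Ψ_neg (hx : S.u₁ β < x) (hx2 : x ≤ S.u₂ β) : S.Ψ β x < 0 := by
  rw [← hS.Ψ_u₁ hβ.mem_Icc]
  exact hS.strictAntiOn_Ψ hβ.mem_Icc le_rfl (fun _ h1 h2 => hβ.m_lt_dgb_of_lt_u₂ hS h1 h2)
    (left_mem_Icc.2 (hβ.u₁_lt_u₂ hS).le) ⟨hx.le, hx2⟩ hx

theorem Ψ_le (hx : S.u₂ β ≤ x) : S.Ψ β x ≤ S.Ψ β (S.u₃ β) := by
  have h1 := (hβ.u₁_lt_u₂ hS).le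
  have h2 := (hβ.u₂_lt_u₃ hS).le
  rcases le_total x (S.u₃ β) with h | h
  · exact (hS.strictMonoOn_Ψ hβ.mem_Icc h1 fun _ h1 h2 => hβ.dgb_lt_m hS h1 h2).monotoneOn
      ⟨hx, h⟩ (right_mem_Icc.2 h2) h
  · exact hS.antitoneOn_Ψ hβ.mem_Icc (h1.trans h2)
      (fun _ h => (hβ.m_lt_dgb_of_u₃_lt hS h).le) (mem_Ici.2 le_rfl) h h

theorem J₁₂_eq : S.J β (S.u₁ β) (S.u₂ β) = S.Ψ β (S.u₂ β) := by
  rw [J_eq_sub (hβ.u₂_spec hS).2, hS.Ψ_u₁ hβ.mem_Icc, sub_zero]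

theorem J₁₃_eq : S.J₁₃ β = S.Ψ β (S.u₃ β) := by
  rw [J₁₃, J_eq_sub (hβ.u₃_spec hS).2, hS.Ψ_u₁ hβ.mem_Icc, sub_zero]

theorem J₂_eq : S.J₂ β = S.Ψ β (S.u₃ β) - S.Ψ β (S.u₂ β) := by
  rw [J₂, J_eq_sub (hβ.u₃_spec hS).2]

variable (hβ' : S.Admissible β') (h : β < β')
include hβ' h

theorem u₃_mem_of_lt : S.u₃ β' ∈ Ioo (S.u₂ β) (S.u₃ β) := by
  have hz := (hβ.u₁_lt_z hS).trans hS.z_lt_xlam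
  have hx := hβ'.xlam_lt_u₃ hS
  obtain ⟨ρ, hρ, hcomp⟩ := hS.exists_factor hβ.mem_Icc hβ'.mem_Icc h hz
  refine hβ.mem_Ioo_of_dgb_lt hS (hz.trans hx) ?_
  have h1 := hcomp _ hx.le
  have hm := hS.m_pos hβ.mem_Icc
  rw [(hβ'.u₃_spec hS).2, div_self (hS.m_pos hβ'.mem_Icc).ne'] at h1
  rw [← div_lt_one hm]
  have h2 : 0 < S.dgb β (S.u₃ β') / S.m β :=
    div_pos (hS.dgb_pos_of_xlam_le hβ.mem_Icc.2 hx.le) hm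
  nlinarith

/-- `J₁₃(β)` is the maximum of `Ψ(β, ·)` over `[u₂(β), ∞)`, and `Ψ` decreases in `β`. -/
theorem J₁₃_le_of_lt : S.J₁₃ β' ≤ S.J₁₃ β := by
  have h1 := hβ.u₃_mem_of_lt hS hβ' h
  rw [hβ.J₁₃_eq hS, hβ'.J₁₃_eq hS]
  refine le_trans ?_ (hβ.Ψ_le hS h1.1.le)
  have h2 := hS.gb_div_m_le hβ.mem_Icc hβ'.mem_Icc h ((hβ.u₁_lt_u₂ hS).trans h1.1).le
  unfold Ψ
  linarith [mul_le_mul_of_nonneg_left h2 hS.k_pos.le]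

end Admissible

namespace Problem

variable (hS : S.Problem)
include hS

/-! ### Continuity in the parameter -/

section Continuity

variable {a b : ℝ} (hadm : ∀ β ∈ Ioo a b, S.Admissible β)
include hadm

/-- The zeros `u₂` and `u₃` of `g'(·; β) - g'(u₁(β); β)` move continuously because the sign
pattern of this function at nearby fixed points is stable. -/
theorem eventually_u₂_u₃ (hβ : β ∈ Ioo a b) {c d e : ℝ} (hc : S.z < c) (hc2 : c < S.u₂ β)
    (hd : d ∈ Ioo (S.u₂ β) (S.u₃ β)) (he : S.u₃ β < e) :
    ∀ᶠ β' in 𝓝[Ioo a b] β, c < S.u₂ β' ∧ S.u₂ β' < d ∧ d < S.u₃ β' ∧ S.u₃ β' < e := by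
  have hA := hadm β hβ
  have hsub : Ioo a b ⊆ Icc (S.h S.z) 1 := fun w hw => (hadm w hw).mem_Icc
  have hz := hS.z_pos
  have hcd := hc2.trans hd.1
  have hde := hd.2.trans he
  have hcont : ∀ {x}, S.z < x →
      Tendsto (fun β => S.dgb β x - S.m β) (𝓝[Ioo a b] β) (𝓝 (S.dgb β x - S.m β)) := fun hx =>
    ((hS.continuousOn_dgb_sub_m (hz.trans hx).le).mono hsub) β hβ
  have h1 := (hcont hc).eventually_const_lt
    (sub_pos.2 (hA.m_lt_dgb_of_lt_u₂ hS ((hA.u₁_lt_z hS).trans hc) hc2))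
  have h2 := (hcont (hc.trans hcd)).eventually_lt_const
    (sub_neg.2 (hA.dgb_lt_m hS hd.1 hd.2))
  have h3 := (hcont (hc.trans (hcd.trans hde))).eventually_const_lt
    (sub_pos.2 (hA.m_lt_dgb_of_u₃_lt hS he))
  filter_upwards [h1, h2, h3, self_mem_nhdsWithin] with β' h1 h2 h3 hβ'
  have hA' := hadm β' hβ'
  have hu := hA'.u₁_lt_z hS
  have hd' := hA'.mem_Ioo_of_dgb_lt hS (hu.trans (hc.trans hcd)) (sub_neg.1 h2)
  refine ⟨?_, hd'.1, hd'.2, ?_⟩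
  · rcases hA'.lt_u₂_or_u₃_lt_of_lt_dgb hS (sub_pos.1 h1) with h | h
    · exact h
    · linarith [hd'.2]
  · rcases hA'.lt_u₂_or_u₃_lt_of_lt_dgb hS (sub_pos.1 h3) with h | h
    · linarith [hd'.1]
    · exact h

theorem continuousOn_u₂ : ContinuousOn S.u₂ (Ioo a b) := by
  intro β hβ
  have hA := hadm β hβ
  obtain ⟨d₀, hd₀⟩ := exists_between (hA.u₂_lt_u₃ hS)
  obtain ⟨c₀, hc₀⟩ := exists_between (hA.z_lt_u₂ hS)
  obtain ⟨e, he⟩ := exists_gt (S.u₃ β)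
  refine tendsto_order.2 ⟨fun c hc => ?_, fun d hd => ?_⟩
  · obtain ⟨w, hw⟩ := exists_between (max_lt hc (hA.z_lt_u₂ hS))
    filter_upwards [hS.eventually_u₂_u₃ hadm hβ ((le_max_right _ _).trans_lt hw.1) hw.2 hd₀ he]
      with β' h using ((le_max_left _ _).trans_lt hw.1).trans h.1
  · obtain ⟨w, hw⟩ := exists_between (lt_min hd (hA.u₂_lt_u₃ hS))
    filter_upwards [hS.eventually_u₂_u₃ hadm hβ hc₀.1 hc₀.2
      ⟨hw.1, hw.2.trans_le (min_le_right _ _)⟩ he]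
      with β' h using h.2.1.trans (hw.2.trans_le (min_le_left _ _))

theorem continuousOn_u₃ : ContinuousOn S.u₃ (Ioo a b) := by
  intro β hβ
  have hA := hadm β hβ
  obtain ⟨d₀, hd₀⟩ := exists_between (hA.u₂_lt_u₃ hS)
  obtain ⟨c₀, hc₀⟩ := exists_between (hA.z_lt_u₂ hS)
  obtain ⟨e, he⟩ := exists_gt (S.u₃ β)
  refine tendsto_order.2 ⟨fun d hd => ?_, fun e he => ?_⟩
  · obtain ⟨w, hw⟩ := exists_between (max_lt hd (hA.u₂_lt_u₃ hS))
    filter_upwards [hS.eventually_u₂_u₃ hadm hβ hc₀.1 hc₀.2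
      ⟨(le_max_right _ _).trans_lt hw.1, hw.2⟩ he]
      with β' h using ((le_max_left _ _).trans_lt hw.1).trans h.2.2.1
  · filter_upwards [hS.eventually_u₂_u₃ hadm hβ hc₀.1 hc₀.2 hd₀ he] with β' h using h.2.2.2

theorem continuousOn_Ψ_u₃ : ContinuousOn (fun β => S.Ψ β (S.u₃ β)) (Ioo a b) :=
  hS.continuousOn_Ψ_comp (fun w hw => (hadm w hw).mem_Icc) (hS.continuousOn_u₃ hadm)
    fun β hβ => hS.xlam_pos.le.trans ((hadm β hβ).xlam_lt_u₃ hS).le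

theorem continuousOn_J₁₃ : ContinuousOn S.J₁₃ (Ioo a b) :=
  (hS.continuousOn_Ψ_u₃ hadm).congr fun β hβ => (hadm β hβ).J₁₃_eq hS

theorem continuousOn_J₂ : ContinuousOn S.J₂ (Ioo a b) :=
  ((hS.continuousOn_Ψ_u₃ hadm).sub
    (hS.continuousOn_Ψ_comp (fun w hw => (hadm w hw).mem_Icc) (hS.continuousOn_u₂ hadm)
      fun β hβ => hS.z_pos.le.trans ((hadm β hβ).z_lt_u₂ hS).le)).congr
    fun β hβ => (hadm β hβ).J₂_eq hS

end Continuity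

/-! ### Behaviour at the ends of `(α₀, β₀)` -/

theorem tendstoUniformlyOn_Ψ (hβ : β ∈ Icc (S.h S.z) 1) (X : ℝ) {ε : ℝ} (hε : 0 < ε) :
    ∀ᶠ β' in 𝓝[Icc (S.h S.z) 1] β, ∀ x ∈ Icc 0 X, |S.Ψ β' x - S.Ψ β x| < ε := by
  obtain ⟨C₁, hC₁⟩ := isCompact_Icc.exists_bound_of_continuousOn
    (hS.c1_g₁.continuousOn.mono (Icc_subset_Ici_self : Icc 0 X ⊆ _))
  obtain ⟨C₂, hC₂⟩ := isCompact_Icc.exists_bound_of_continuousOn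
    (hS.c1_g₂.continuousOn.mono (Icc_subset_Ici_self : Icc 0 X ⊆ _))
  have hm := hS.continuousOn_m β hβ
  have hm0 := (hS.m_pos hβ).ne'
  have hinv : ContinuousWithinAt (fun β => (S.m β)⁻¹) (Icc (S.h S.z) 1) β := hm.inv₀ hm0
  have hlim : ContinuousWithinAt (fun β' => S.k * (|C₂| * |(S.m β')⁻¹ - (S.m β)⁻¹| +
      |C₁| * |β' * (S.m β')⁻¹ - β * (S.m β)⁻¹|)) (Icc (S.h S.z) 1) β :=
    continuousWithinAt_const.mul ((continuousWithinAt_const.mul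
      (hinv.sub continuousWithinAt_const).abs).add (continuousWithinAt_const.mul
      ((continuousWithinAt_id.mul hinv).sub continuousWithinAt_const).abs))
  have hev := hlim.tendsto.eventually_lt_const (by simpa using hε)
  filter_upwards [hev] with β' hβ' x hx
  refine lt_of_le_of_lt ?_ hβ'
  have h1 : S.Ψ β' x - S.Ψ β x = -S.k * (S.g₂ x * ((S.m β')⁻¹ - (S.m β)⁻¹) -
      S.g₁ x * (β' * (S.m β')⁻¹ - β * (S.m β)⁻¹)) := by
    unfold Ψ gb
    simp only [div_eq_mul_inv]
    ring
  rw [h1, abs_mul, abs_neg, abs_of_pos hS.k_pos]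
  refine mul_le_mul_of_nonneg_left ((abs_sub _ _).trans ?_) hS.k_pos.le
  rw [abs_mul, abs_mul]
  have h2 := (hC₁ x hx).trans (le_abs_self _)
  have h3 := (hC₂ x hx).trans (le_abs_self _)
  rw [Real.norm_eq_abs] at h2 h3
  gcongr

/-- As `β ↑ β₀`, the interval on which `g'(·; β) < g'(u₁(β); β)` disappears. -/
theorem eventually_J_lt (hInf : (S.h S.z : EReal) < S.hInf)
    (hh : S.hInf = 1 ∨ (S.hInf < 1 ∧ 1 < S.G S.hInf.toReal)) {a : ℝ} (ha : a < S.β₀)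
    (hadm : ∀ β ∈ Ioo a S.β₀, S.Admissible β) :
    ∀ᶠ β in 𝓝[<] S.β₀, S.J₁₃ β < 0 ∧ S.J₂ β < S.K := by
  have hmem := hS.β₀_mem_Icc hInf
  have huz := hS.u₁_lt_z ⟨hS.h_z_lt_β₀ hInf, hmem.2⟩
  have hanti : AntitoneOn (S.Ψ S.β₀) (Ici S.z) := by
    refine hS.antitoneOn_Ψ hmem huz.le fun x hx => ?_
    rcases le_total x S.xlam with h | h
    · have hM := (hS.hMinus_spec hmem).1.2.trans hx.le
      exact (hS.m_β₀_le hInf hh le_rfl).trans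
        ((hS.strictAntiOn_dgb_xlam hmem).antitoneOn ⟨hM, h⟩ ⟨hM.trans h, le_rfl⟩ h)
    · exact hS.m_β₀_le hInf hh h
  have hneg : S.Ψ S.β₀ S.z < 0 := by
    rw [← hS.Ψ_u₁ hmem]
    exact hS.strictAntiOn_Ψ hmem le_rfl (fun _ h1 h2 => hS.m_lt_dgb_of_le_z hmem h1 h2.le)
      (left_mem_Icc.2 huz.le) (right_mem_Icc.2 huz.le) huz
  obtain ⟨β₁, hβ₁⟩ := exists_between ha
  have hA₁ := hadm β₁ hβ₁
  have hε : 0 < min (-S.Ψ S.β₀ S.z) (S.K / 2) := lt_min (neg_pos.2 hneg) (half_pos hS.K_pos)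
  have hle : 𝓝[<] S.β₀ ≤ 𝓝[Icc (S.h S.z) 1] S.β₀ := by
    rw [← nhdsWithin_Ioo_eq_nhdsLT ha]
    exact nhdsWithin_mono _ fun w hw => (hadm w hw).mem_Icc
  filter_upwards [hle (hS.tendstoUniformlyOn_Ψ hmem (S.u₃ β₁) hε), Ioo_mem_nhdsLT hβ₁.2]
    with β hΨ hβ
  have hA := hadm β ⟨hβ₁.1.trans hβ.1, hβ.2⟩
  have h3 := (hA₁.u₃_mem_of_lt hS hA hβ.1).2.le
  have hz2 := (hA.z_lt_u₂ hS).le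
  have h23 := (hA.u₂_lt_u₃ hS).le
  have e3 := abs_lt.1 (hΨ _ ⟨hS.z_pos.le.trans (hz2.trans h23), h3⟩)
  have e2 := abs_lt.1 (hΨ _ ⟨hS.z_pos.le.trans hz2, h23.trans h3⟩)
  have m1 := min_le_left (-S.Ψ S.β₀ S.z) (S.K / 2)
  have m2 := min_le_right (-S.Ψ S.β₀ S.z) (S.K / 2)
  have d1 := hanti (mem_Ici.2 le_rfl) (mem_Ici.2 (hz2.trans h23)) (hz2.trans h23)
  have d2 := hanti (mem_Ici.2 hz2) (mem_Ici.2 (hz2.trans h23)) h23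
  rw [hA.J₁₃_eq hS, hA.J₂_eq hS]
  constructor <;> linarith [e3.2, e2.1]

/-- At `β = h(z)` the points `u₁` and `u₂` collapse to `z`, so that `J₁₃ > 0` nearby. -/
theorem exists_J₁₃_pos {b : ℝ} (hb : S.h S.z < b)
    (hadm : ∀ β ∈ Ioo (S.h S.z) b, S.Admissible β) : ∃ β ∈ Ioo (S.h S.z) b, 0 < S.J₁₃ β := by
  have hmem := hS.h_z_mem
  have hzl := hS.z_lt_xlam.le
  have hMz := (hS.hMinus_spec hmem).1.2
  have hpos : 0 < S.Ψ (S.h S.z) S.xlam := by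
    rw [← hS.Ψ_u₁ hmem, hS.u₁_h_z]
    refine hS.strictMonoOn_Ψ hmem hS.u₁_h_z.le (fun x h1 h2 => ?_) (left_mem_Icc.2 hzl)
      (right_mem_Icc.2 hzl) hS.z_lt_xlam
    rw [m, hS.u₁_h_z]
    exact hS.strictAntiOn_dgb_xlam hmem ⟨hMz, hzl⟩ ⟨hMz.trans h1.le, h2.le⟩ h1
  have hc : ContinuousOn (fun β => S.Ψ β S.xlam) (Icc (S.h S.z) 1) :=
    hS.continuousOn_Ψ_comp Subset.rfl continuousOn_const fun _ _ => hS.xlam_pos.le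
  have hle : 𝓝[>] S.h S.z ≤ 𝓝[Icc (S.h S.z) 1] S.h S.z := by
    rw [← nhdsWithin_Ioo_eq_nhdsGT hb]
    exact nhdsWithin_mono _ fun w hw => (hadm w hw).mem_Icc
  have hev : ∀ᶠ β in 𝓝[>] S.h S.z, 0 < S.Ψ β S.xlam :=
    hle ((hc _ hmem).tendsto.eventually_const_lt hpos)
  obtain ⟨β, hβ, hβI⟩ := (hev.and (Ioo_mem_nhdsGT hb)).exists
  have hA := hadm β hβI
  refine ⟨β, hβI, ?_⟩
  rw [hA.J₁₃_eq hS]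
  refine hβ.trans_le (hA.Ψ_le hS (le_of_not_gt fun h => ?_))
  exact hβ.not_gt (hA.Ψ_neg hS ((hA.u₁_lt_z hS).trans hS.z_lt_xlam) h.le)

end Problem

end Data

/-! ### Crossing arguments -/

section Crossing

variable {a b K : ℝ} {φ ψ : ℝ → ℝ}

/-- Start from the last zero of `φ`; if `ψ > K` there, `ψ` crosses the level `K` later on. -/
theorem exists_zero_or_crossing (hφ : ContinuousOn φ (Ioo a b)) (hψ : ContinuousOn ψ (Ioo a b))
    (hend : ∀ᶠ x in 𝓝[<] b, φ x < 0 ∧ ψ x < K) {p : ℝ} (hp : p ∈ Ioo a b) (hφp : 0 ≤ φ p) :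
    ∃ x ∈ Ioo a b, (φ x = 0 ∧ ψ x ≤ K) ∨ (φ x < 0 ∧ ψ x = K) := by
  obtain ⟨e, ⟨he1, he2⟩, he⟩ := (hend.and (Ioo_mem_nhdsLT hp.2)).exists
  have hsub : Icc p e ⊆ Ioo a b := fun w hw => ⟨hp.1.trans_le hw.1, hw.2.trans_lt he.2⟩
  have hclosed : IsClosed {x | x ∈ Icc p e ∧ φ x ∈ Ici 0} :=
    (hφ.mono hsub).preimage_isClosed_of_isClosed isClosed_Icc isClosed_Ici
  have hcompact : IsCompact {x | x ∈ Icc p e ∧ φ x ∈ Ici 0} :=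
    isCompact_Icc.of_isClosed_subset hclosed fun x hx => hx.1
  obtain ⟨q, hq, hqmax⟩ := hcompact.exists_isGreatest ⟨p, left_mem_Icc.2 he.1.le, hφp⟩
  have hq0 : 0 ≤ φ q := hq.2
  have hqe : q < e := hq.1.2.lt_of_ne fun h => by
    rw [h] at hq0
    exact hq0.not_gt he1
  have hneg : ∀ x, q < x → x ≤ e → φ x < 0 := fun x hx hxe => by
    by_contra! h
    exact not_lt.2 (hqmax ⟨⟨hq.1.1.trans hx.le, hxe⟩, h⟩) hx
  have hqI := hsub hq.1
  have hzero : φ q = 0 := by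
    refine le_antisymm ?_ hq0
    refine le_of_tendsto (((hφ.continuousAt (Ioo_mem_nhds hqI.1 hqI.2)).tendsto.mono_left
      nhdsWithin_le_nhds) : Tendsto _ (𝓝[>] q) _) ?_
    filter_upwards [Ioo_mem_nhdsGT hqe] with x hx using (hneg x hx.1 hx.2.le).le
  rcases le_or_gt (ψ q) K with h | h
  · exact ⟨q, hqI, Or.inl ⟨hzero, h⟩⟩
  · obtain ⟨x, hx, hxK⟩ := intermediate_value_Ioo' hqe.le
      (hψ.mono fun w hw => hsub ⟨hq.1.1.trans hw.1, hw.2⟩) (show K ∈ _ from ⟨he2, h⟩)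
    exact ⟨x, hsub ⟨hq.1.1.trans hx.1.le, hx.2.le⟩, Or.inr ⟨hneg x hx.1 hx.2.le, hxK⟩⟩

theorem exists_crossing (hψ : ContinuousOn ψ (Ioo a b)) (hend : ∀ᶠ x in 𝓝[<] b, ψ x < K)
    {p : ℝ} (hp : p ∈ Ioo a b) (hψp : K < ψ p) : ∃ x ∈ Ioo a b, ψ x = K := by
  obtain ⟨e, he1, he⟩ := (hend.and (Ioo_mem_nhdsLT hp.2)).exists
  have hsub : Icc p e ⊆ Ioo a b := fun w hw => ⟨hp.1.trans_le hw.1, hw.2.trans_lt he.2⟩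
  obtain ⟨x, hx, hxK⟩ := intermediate_value_Icc' he.1.le (hψ.mono hsub)
    (show K ∈ _ from ⟨he1.le, hψp.le⟩)
  exact ⟨x, hsub hx, hxK⟩

end Crossing

namespace Data

variable {S : Data} {β : ℝ}

theorem exists_mem_Ioo_of_lt_limRight {f : ℝ → ℝ} {a b c : ℝ} (hab : a < b)
    (h : (c : EReal) < limRight f a) : ∃ x ∈ Ioo a b, c < f x := by
  obtain ⟨x, hx, hxI⟩ := ((frequently_lt_of_lt_limsup (by isBoundedDefault) h).and_eventually
    (Ioo_mem_nhdsGT hab)).exists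
  exact ⟨x, hxI, EReal.coe_lt_coe_iff.1 hx⟩

theorem Problem.J₁₃_neg (hS : S.Problem) {a b : ℝ} (hadm : ∀ β ∈ Ioo a b, S.Admissible β)
    (h : limRight S.J₁₃ a < 0) (hβ : β ∈ Ioo a b) : S.J₁₃ β < 0 := by
  have hev := eventually_lt_of_limsup_lt h (by isBoundedDefault)
  obtain ⟨w, hw, hwI⟩ := (hev.and (Ioo_mem_nhdsGT hβ.1)).exists
  have h1 := (hadm w ⟨hwI.1, hwI.2.trans hβ.2⟩).J₁₃_le_of_lt hS (hadm β hβ) hwI.2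
  have h2 : S.J₁₃ w < 0 := by exact_mod_cast hw
  exact h1.trans_lt h2

/-- Either `J₁₃ ≥ 0` somewhere on `(α₀, β₀)`, or `J₁₃ < 0` throughout and `J₂` starts above `K`. -/
theorem Problem.exists_parameter (hS : S.Problem)
    (hG : S.CaseG1 ∨ S.CaseG2 ∨ S.CaseG3)
    (hedge : ¬ (S.CaseG2 ∧ S.J₁₃Start = 0 ∧ S.J₂Start ≤ (S.K : EReal)))
    (hInf : (S.h S.z : EReal) < S.hInf)
    (hh : S.hInf = 1 ∨ (S.hInf < 1 ∧ 1 < S.G S.hInf.toReal)) (hex : S.AlphaZeroExists) :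
    ∃ β ∈ Ioo S.α₀ S.β₀,
      ((S.J₁₃ β = 0 ∧ S.J₂ β ≤ S.K) ∨ (S.J₁₃ β < 0 ∧ S.J₂ β = S.K)) ∧
      (S.CaseG3 → S.J₁₃ β < 0 ∧ S.J₂ β = S.K) := by
  have hα := hS.α₀_mem hInf hex
  have hadm : ∀ β ∈ Ioo S.α₀ S.β₀, S.Admissible β := fun β hβ => hS.admissible hInf hex hβ
  have hend := hS.eventually_J_lt hInf hh hα.2 hadm
  have hc13 := hS.continuousOn_J₁₃ hadm
  have hc2 := hS.continuousOn_J₂ hadm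
  have hnonneg : (∃ p ∈ Ioo S.α₀ S.β₀, 0 ≤ S.J₁₃ p) →
      ∃ β ∈ Ioo S.α₀ S.β₀, (S.J₁₃ β = 0 ∧ S.J₂ β ≤ S.K) ∨ (S.J₁₃ β < 0 ∧ S.J₂ β = S.K) :=
    fun ⟨p, hp, hp0⟩ => exists_zero_or_crossing hc13 hc2 hend hp hp0
  have hneg : (∀ β ∈ Ioo S.α₀ S.β₀, S.J₁₃ β < 0) → (S.K : EReal) < S.J₂Start →
      ∃ β ∈ Ioo S.α₀ S.β₀, S.J₁₃ β < 0 ∧ S.J₂ β = S.K := fun hall hstart => by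
    obtain ⟨p, hp, hpK⟩ := exists_mem_Ioo_of_lt_limRight hα.2 hstart
    obtain ⟨β, hβ, hβK⟩ := exists_crossing hc2 (hend.mono fun _ h => h.2) hp hpK
    exact ⟨β, hβ, hall β hβ, hβK⟩
  rcases hG with hG | hG | hG
  · have hα0 : S.α₀ = S.h S.z := if_pos hG
    obtain ⟨p, hp, hp0⟩ := hS.exists_J₁₃_pos (hα0 ▸ hα.2) (hα0 ▸ hadm)
    obtain ⟨β, hβ, h⟩ := hnonneg ⟨p, hα0 ▸ hp, hp0.le⟩
    exact ⟨β, hβ, h, fun h3 => absurd h3.1 (not_lt.2 hG)⟩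
  · suffices h : ∃ β ∈ Ioo S.α₀ S.β₀,
        (S.J₁₃ β = 0 ∧ S.J₂ β ≤ S.K) ∨ (S.J₁₃ β < 0 ∧ S.J₂ β = S.K) by
      obtain ⟨β, hβ, h⟩ := h
      exact ⟨β, hβ, h, fun h3 => absurd h3.2.2.1 (not_lt.2 hG.2.2)⟩
    by_cases hp : ∃ p ∈ Ioo S.α₀ S.β₀, 0 ≤ S.J₁₃ p
    · exact hnonneg hp
    push Not at hp
    rcases hG.2.2.eq_or_lt with h0 | h0
    · obtain ⟨β, hβ, h⟩ := hneg hp (lt_of_not_ge fun h => hedge ⟨hG, h0.symm, h⟩)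
      exact ⟨β, hβ, Or.inr h⟩
    · obtain ⟨p, hpI, hp0⟩ := exists_mem_Ioo_of_lt_limRight hα.2
        (show ((0 : ℝ) : EReal) < limRight S.J₁₃ S.α₀ from h0)
      exact absurd (hp p hpI) hp0.not_gt
  · obtain ⟨β, hβ, h⟩ := hneg (fun β hβ => hS.J₁₃_neg hadm hG.2.2.1 hβ) hG.2.2.2
    exact ⟨β, hβ, Or.inr h, fun _ => h⟩

end Data

end DividendProblem

theorem proposition2p2 (S : DividendProblem.Data) (hS : S.Problem)
    (hG : S.CaseG1 ∨ S.CaseG2 ∨ S.CaseG3)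
    (hedge : ¬ (S.CaseG2 ∧ S.J₁₃Start = 0 ∧ S.J₂Start ≤ (S.K : EReal)))
    (hh : S.hInf = 1 ∨
      ((S.h S.z : EReal) < S.hInf ∧ S.hInf < 1 ∧ 1 < S.G S.hInf.toReal)) :
    ∃ β ∈ Set.Ioo S.α₀ S.β₀,
      (S.ubar < S.u₁ β ∧ S.u₁ β < S.hMinus β ∧ S.hMinus β < S.z ∧ S.z < S.u₂ β ∧
        S.u₂ β < S.hPlus β ∧ S.hPlus β < S.u₃ β) ∧
      (S.dgb β (S.u₁ β) ≠ 0 ∧ S.γ β (S.u₁ β) = 0) ∧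
      (S.dgb β (S.u₁ β) = S.dgb β (S.u₂ β) ∧ S.dgb β (S.u₂ β) = S.dgb β (S.u₃ β)) ∧
      Xor
        (-S.J β (S.u₁ β) (S.u₂ β) = S.J β (S.u₂ β) (S.u₃ β) ∧
          S.J β (S.u₂ β) (S.u₃ β) ≤ S.K)
        (-S.J β (S.u₁ β) (S.u₂ β) > S.J β (S.u₂ β) (S.u₃ β) ∧
          S.J β (S.u₂ β) (S.u₃ β) = S.K) ∧
      (S.CaseG3 →
        -S.J β (S.u₁ β) (S.u₂ β) > S.J β (S.u₂ β) (S.u₃ β) ∧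
          S.J β (S.u₂ β) (S.u₃ β) = S.K) := by
  have hInf : (S.h S.z : EReal) < S.hInf := by
    rcases hh with h | h
    · rw [h]
      exact_mod_cast hS.h_z_lt_one
    · exact h.1
  have hex : S.AlphaZeroExists := by
    rcases hG with h | h | h
    · exact Or.inl h
    · exact h.2.1
    · exact h.2.1
  obtain ⟨β, hβ, hcases, hG3⟩ :=
    hS.exists_parameter hG hedge hInf (hh.imp_right fun h => h.2) hex
  have hA := hS.admissible hInf hex hβ
  obtain ⟨h2, h2m⟩ := hA.u₂_spec hS
  obtain ⟨h3, h3m⟩ := hA.u₃_spec hS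
  have hJ : S.J₁₃ β = S.J β (S.u₂ β) (S.u₃ β) + S.J β (S.u₁ β) (S.u₂ β) := by
    rw [hA.J₁₂_eq hS, hA.J₁₃_eq hS]
    have := hA.J₂_eq hS
    unfold DividendProblem.Data.J₂ at this
    linarith
  have hb : S.J₁₃ β < 0 ∧ S.J₂ β = S.K → -S.J β (S.u₁ β) (S.u₂ β) > S.J β (S.u₂ β) (S.u₃ β) ∧
      S.J β (S.u₂ β) (S.u₃ β) = S.K := fun h => ⟨by linarith [h.1], h.2⟩
  refine ⟨β, hβ, ⟨hS.ubar_lt_u₁ ⟨hA.mem.1.le, hA.mem.2⟩, hS.u₁_lt_hMinus hA.mem_Ioc,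
    hS.hMinus_lt_z hA.mem_Ioc, hA.z_lt_u₂ hS, h2.2, h3⟩,
    ⟨(hS.m_pos hA.mem_Icc).ne', hS.γ_u₁ hA.mem_Icc⟩, ⟨h2m.symm, h2m.trans h3m.symm⟩, ?_,
    fun h => hb (hG3 h)⟩
  rcases hcases with h | h
  · exact Or.inl ⟨⟨by linarith [h.1], h.2⟩, fun h' => by linarith [h.1, h'.1]⟩
  · exact Or.inr ⟨hb h, fun h' => by linarith [h.1, h'.1]⟩
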